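/- Let $\varphi\in(0,\pi)$ and $\psi\in[0,\pi]$ with $\varphi+\psi\ne\pi$. The canonical bryophyllum $B=\mathrm{Br}_{\varphi,\psi}$ consists of the following data, where $r=\cos(\varphi/2+\psi)/\cos(\varphi/2)$. Vertices: $A_0=1$, $A_+=e^{i\varphi}$, $A_-=e^{-i\varphi}$. Edges: $s_\pm$ is the straight line segment $[A_\pm,A_0]$; if $\psi\neq\varphi/2$, then $s_0$ is the arc with end points $A_+$ and $A_-$, containing $re^{i\psi}$, of the circle through $A_+$, $A_-$, $re^{i\psi}$; if $\psi=\varphi/2$, then $s_0$ is the straight line segment $[A_+,A_-]$. Maps: $T_+$ and $T_-$ are the maps $$T_{\pm}(z)=\frac{\left(re^{\pm i\psi}-\cos(\varphi/2)\,e^{\pm i\varphi/2}\right)z+\left(\cos(\varphi/2)\,e^{\pm i\varphi/2}-r\cos(\varphi)\,e^{\pm i\psi}\right)}{\left(r\cos(\varphi/2)\,e^{\pm i(\psi-\varphi/2)}-\cos\varphi\right)z+\left(1-r\cos(\varphi/2)\,e^{\pm i(\psi-\varphi/2)}\right)}.$$ Let $\Delta_B$ be the closure of the bounded component of $\mathbb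 C\setminus(s_+\cup s_-\cup s_0)$. Suppose that $B$ is Farey, that is: - (Edge Condition) $s_+\cap s_-=\{A_0\}$, $s_+\cap s_0=\{A_+\}$ and $s_-\cap s_0=\{A_-\}$; - (Inclusion Condition) $T_+(\Delta_B)\subset\Delta_B$ and $T_-(\Delta_B)\subset\Delta_B$; - (Separation Condition) $T_+(\Delta_B)\cap T_-(\Delta_B)=\{A_0\}$. For finite binary sequences define $\Delta_B()=\Delta_B$ and, for $n\ge1$, $$\Delta_B(x_1,\dots,x_n)=\begin{cases}(T_+\circ\mathrm{conj})\big(\Delta_B(x_2,\dots,x_n)\big)&\text{if }x_1=1,\\(T_-\circ\mathrm{conj})\big(\Delta_B(x_2,\dots,x_n)\big)&\text{if }x_1=0,\end{cases}$$ where $\mathrm{conj}$ is complex conjugation. Then for every infinite binary sequence $x=(x_k)_{k\ge1}$ the sets $\Delta_B(x_1,\dots,x_n)$ are nested, $$\Delta_B(x_1,\dots,x_n,x_{n+1})\subset\Delta_B(x_1,\dots,x_n)\qquad(n\ge0),$$ and their intersection $\bigcap_{n=1}^{\infty}\Delta_B(x_1,\dots,x_n)$ consists of exactly one point (denoted $\dot\Delta_B(x)$).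 -/

import Mathlib

open scoped ComplexConjugate

noncomputable section

namespace Bryophyllum

/-- The arc with end points `a` and `b` through `q` of the circle through the three
(non-collinear) points `a`, `b`, `q`: the points of that circle lying on the same closed side
of the line `ab` as `q`. -/
def circArc (a b q : ℂ) : Set ℂ :=
  {z | EuclideanGeometry.Cospherical ({a, b, q, z} : Set ℂ) ∧ (line[ℝ, a, b]).WSameSide z q}

/-- The signed modulus `r = cos (φ/2 + ψ) / cos (φ/2)`. -/
def radius (φ ψ : ℝ) : ℝ := Real.cos (φ / 2 + ψ) / Real.cos (φ / 2)

/-- The vertex `A₀ = 1`. -/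
def vertexZero : ℂ := 1

/-- The vertex `A₊ = e^{iφ}`. -/
def vertexPlus (φ : ℝ) : ℂ := Complex.exp (φ * Complex.I)

/-- The vertex `A₋ = e^{-iφ}`. -/
def vertexMinus (φ : ℝ) : ℂ := Complex.exp (-φ * Complex.I)

/-- The edge `s₊`, the straight segment between `A₊` and `A₀`. -/
def edgePlus (φ : ℝ) : Set ℂ := segment ℝ (vertexPlus φ) vertexZero

/-- The edge `s₋`, the straight segment between `A₋` and `A₀`. -/
def edgeMinus (φ : ℝ) : Set ℂ := segment ℝ (vertexMinus φ) vertexZero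

open Classical in
/-- The edge `s₀` between `A₊` and `A₋`: a straight segment if `ψ = φ/2`, and otherwise the arc
through `r e^{iψ}` of the circle through `A₊`, `A₋`, `r e^{iψ}`. -/
def edgeZero (φ ψ : ℝ) : Set ℂ :=
  if ψ = φ / 2 then segment ℝ (vertexPlus φ) (vertexMinus φ)
  else circArc (vertexPlus φ) (vertexMinus φ) (radius φ ψ * Complex.exp (ψ * Complex.I))

/-- The common formula for the two Möbius maps: `T₊` is the case `ε = 1` and `T₋` is the case
`ε = -1`, where `ε` is the sign in `e^{± i ...}`. -/
def moebius (φ ψ ε : ℝ) (z : ℂ) : ℂ :=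
  ((radius φ ψ * Complex.exp (ε * ψ * Complex.I)
        - Real.cos (φ / 2) * Complex.exp (ε * (φ / 2) * Complex.I)) * z
      + (Real.cos (φ / 2) * Complex.exp (ε * (φ / 2) * Complex.I)
        - radius φ ψ * Real.cos φ * Complex.exp (ε * ψ * Complex.I))) /
    ((radius φ ψ * Real.cos (φ / 2) * Complex.exp (ε * (ψ - φ / 2) * Complex.I)
        - Real.cos φ) * z
      + (1 - radius φ ψ * Real.cos (φ / 2) * Complex.exp (ε * (ψ - φ / 2) * Complex.I)))

/-- The map `T₊`. -/
def mapPlus (φ ψ : ℝ) : ℂ → ℂ := moebius φ ψ 1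

/-- The map `T₋`. -/
def mapMinus (φ ψ : ℝ) : ℂ → ℂ := moebius φ ψ (-1)

/-- The union of the three edges. -/
def edges (φ ψ : ℝ) : Set ℂ := edgePlus φ ∪ edgeMinus φ ∪ edgeZero φ ψ

/-- The interior of the curvilinear triangle. The lines carrying `s₊` and `s₋` meet in `A₀` and
`∞`, so this is the connected component of the complement of the edges in the Riemann sphere
that does not contain `∞`, that is, the bounded component of the complement in `ℂ`. -/
def openTriangle (φ ψ : ℝ) : Set ℂ :=
  {z | z ∉ edges φ ψ ∧ Bornology.IsBounded (connectedComponentIn (edges φ ψ)ᶜ z)}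

/-- The closed curvilinear triangle `Δ_B`. -/
def triangle (φ ψ : ℝ) : Set ℂ := closure (openTriangle φ ψ)

/-- The canonical bryophyllum with parameters `φ`, `ψ` is Farey. -/
structure IsFarey (φ ψ : ℝ) : Prop where
  edge_plus_minus : edgePlus φ ∩ edgeMinus φ = {vertexZero}
  edge_plus_zero : edgePlus φ ∩ edgeZero φ ψ = {vertexPlus φ}
  edge_minus_zero : edgeMinus φ ∩ edgeZero φ ψ = {vertexMinus φ}
  inclusion_plus : mapPlus φ ψ '' triangle φ ψ ⊆ triangle φ ψ
  inclusion_minus : mapMinus φ ψ '' triangle φ ψ ⊆ triangle φ ψ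
  separation : mapPlus φ ψ '' triangle φ ψ ∩ mapMinus φ ψ '' triangle φ ψ = {vertexZero}

/-- The iterated triangle `Δ_B(x₁, …, xₙ)` of a finite binary sequence; the digit `1` is `true`
and the digit `0` is `false`. -/
def iterTriangle (φ ψ : ℝ) : List Bool → Set ℂ
  | [] => triangle φ ψ
  | true :: l => (mapPlus φ ψ ∘ conj) '' iterTriangle φ ψ l
  | false :: l => (mapMinus φ ψ ∘ conj) '' iterTriangle φ ψ l

/-- The finite sequence of the first `n` terms of an infinite binary sequence, whose terms
`x₁, x₂, …` are `x 0, x 1, …`. -/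
def initial (x : ℕ → Bool) (n : ℕ) : List Bool := List.ofFn fun i : Fin n => x i

end Bryophyllum

end

/-!
The map `f₊ = T₊ ∘ conj` fixes `A₊` and takes `A₋` to `1` and `1` to `r e^{iψ}`; the map
`f₋ = T₋ ∘ conj` is its reflection in the real axis. Nestedness of the iterated triangles is the
Inclusion Condition together with the symmetry of `Δ_B` under conjugation. That the intersection is
a single point is proved by replacing `Δ_B` with a round disc.

Consider the disc `𝔻` through `A₊` and `A₋` whose boundary circle is perpendicular at `A₊` to the
bisector of the angle between `s₊` and `s₀`. The derivative of `f₊` at `A₊` exchanges the directions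
of `s₊` and `s₀`, so it preserves the tangent of this circle. If `1` is an interior point of `𝔻`,
then `f₊` maps `𝔻` to a disc inside `𝔻` that touches the boundary at `A₊` only, and likewise for
`f₋` and `A₋` (`exists_disc`). Moreover `Δ_B ⊆ 𝔻`, because a bounded component of the complement of
the edges lies in every disc that contains the edges (`triangle_subset_closedBall`,
`edges_subset_disc`).

Two such maps shrink the disc along every infinite word (`exists_wordMap_small`). Neither increases
`|z - w|² / (p(z) p(w))`, where `p` is the power with respect to the circle, a function of the
hyperbolic distance. At each change of letter, points come from the image of the other map, hence
stay away from the tip, and the quantity drops by a fixed factor; so it tends to zero if the letters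
change infinitely often. If the word is eventually constant, then the images lie in discs tangent to
the circle at the fixed point whose curvatures grow at least linearly, provided that the fixed point
is not repelling.

What is needed of the parameters is `φ + ψ < π` (then `1` is interior to `𝔻`) and
`sin (φ - ψ) ≤ 2 sin ψ` (then `A₊` is not repelling). Both follow from the Farey conditions.
If the second inequality fails, `s₊` meets the arc `s₀` in a point other than `A₊`, against the Edge
Condition. If `φ + ψ > π` and `ψ ≠ φ/2`, the pole of `T₊` lies on the arc `s₀`, and an explicit
description of the inner side of that arc shows that it is a limit of points of bounded components;
then `T₊` is unbounded on `Δ_B`, against the Inclusion Condition. If `φ + ψ > π` and `ψ = φ/2`, the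
map `T₊` is a similarity of ratio larger than one, which cannot map `Δ_B` into itself.
-/

noncomputable section

namespace Bryophyllum

/-! ### Maps that contract a disc and touch its boundary at one point -/

section

/-- The power of the point `z` with respect to the circle of centre `m` and radius `lam`, with the
sign that makes it positive inside. -/
def depth (m lam : ℝ) (z : ℂ) : ℝ := lam ^ 2 - ‖z - m‖ ^ 2

/-- A (holomorphic or antiholomorphic) Möbius map `f` that sends the disc `{depth ≥ 0}` into
itself, touches its boundary circle only at the fixed point `A`, and does not expand at `A`.
Here `d z` is the squared modulus of the denominator of `f` at `z`, and `D` is the modulus of its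
determinant. -/
structure TangentContraction (m lam D v : ℝ) (A : ℂ) (f : ℂ → ℂ) (d : ℂ → ℝ) : Prop where
  D_pos : 0 < D
  v_pos : 0 < v
  d_pos : ∀ z, 0 ≤ depth m lam z → 0 < d z
  d_cont : Continuous d
  depth_map : ∀ z, 0 ≤ depth m lam z →
    depth m lam (f z) * d z = D * depth m lam z + v * ‖z - A‖ ^ 2
  dist_map : ∀ z w, 0 ≤ depth m lam z → 0 ≤ depth m lam w →
    ‖f z - f w‖ ^ 2 * (d z * d w) = D ^ 2 * ‖z - w‖ ^ 2
  fixed : f A = A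
  depth_tip : depth m lam A = 0
  D_le : D ≤ d A

variable {m lam D v : ℝ}

lemma depth_le (z : ℂ) : depth m lam z ≤ lam ^ 2 := by
  unfold depth; nlinarith [sq_nonneg ‖z - m‖]

lemma depth_nonneg_iff (hlam : 0 ≤ lam) (z : ℂ) :
    0 ≤ depth m lam z ↔ z ∈ Metric.closedBall (m : ℂ) lam := by
  rw [depth, sub_nonneg, Metric.mem_closedBall, dist_eq_norm]
  exact sq_le_sq₀ (norm_nonneg _) hlam

lemma isCompact_depth_nonneg (hlam : 0 ≤ lam) : IsCompact {z : ℂ | 0 ≤ depth m lam z} := by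
  have : {z : ℂ | 0 ≤ depth m lam z} = Metric.closedBall (m : ℂ) lam := by
    ext z; exact depth_nonneg_iff hlam z
  rw [this]; exact isCompact_closedBall _ _

namespace TangentContraction

variable {A : ℂ} {f : ℂ → ℂ} {d : ℂ → ℝ}

lemma depth_map_nonneg (h : TangentContraction m lam D v A f d) {z : ℂ}
    (hz : 0 ≤ depth m lam z) : 0 ≤ depth m lam (f z) := by
  have h1 := h.depth_map z hz
  have h2 : 0 ≤ D * depth m lam z + v * ‖z - A‖ ^ 2 := by
    have := h.D_pos; have := h.v_pos; positivity
  exact nonneg_of_mul_nonneg_left (h1 ▸ h2) (h.d_pos z hz)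

/-- Only the tip is mapped to the boundary circle. -/
lemma depth_map_pos (h : TangentContraction m lam D v A f d) {z : ℂ}
    (hz : 0 ≤ depth m lam z) (hzA : z ≠ A) : 0 < depth m lam (f z) := by
  have h1 := h.depth_map z hz
  have h3 : 0 < ‖z - A‖ := norm_pos_iff.2 (sub_ne_zero.2 hzA)
  have h2 : 0 < D * depth m lam z + v * ‖z - A‖ ^ 2 := by
    have := h.D_pos; have := h.v_pos; positivity
  exact pos_of_mul_pos_left (h1 ▸ h2) (h.d_pos z hz).le

lemma exists_lipschitz (h : TangentContraction m lam D v A f d) (hlam : 0 ≤ lam) :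
    ∃ K : ℝ, 0 < K ∧ ∀ z w, 0 ≤ depth m lam z → 0 ≤ depth m lam w →
      ‖f z - f w‖ ≤ K * ‖z - w‖ := by
  have hne : {z : ℂ | 0 ≤ depth m lam z}.Nonempty := ⟨A, h.depth_tip.ge⟩
  obtain ⟨z₀, hz₀, hmin⟩ := (isCompact_depth_nonneg (m := m) hlam).exists_isMinOn hne
    h.d_cont.continuousOn
  have hμ : 0 < d z₀ := h.d_pos z₀ hz₀
  have hD := h.D_pos
  refine ⟨D / d z₀, by positivity, fun z w hz hw => ?_⟩
  have hz' : d z₀ ≤ d z := hmin hz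
  have hw' : d z₀ ≤ d w := hmin hw
  have key := h.dist_map z w hz hw
  have h1 : ‖f z - f w‖ ^ 2 * (d z₀ * d z₀) ≤ D ^ 2 * ‖z - w‖ ^ 2 := by
    rw [← key]
    exact mul_le_mul_of_nonneg_left (mul_le_mul hz' hw' hμ.le (hμ.le.trans hz')) (sq_nonneg _)
  rw [div_mul_eq_mul_div, le_div_iff₀ hμ]
  refine (abs_le_of_sq_le_sq' ?_ (by positivity)).2
  nlinarith

lemma continuousOn (h : TangentContraction m lam D v A f d) (hlam : 0 ≤ lam) :
    ContinuousOn f {z | 0 ≤ depth m lam z} := by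
  obtain ⟨K, hK, hL⟩ := h.exists_lipschitz hlam
  refine LipschitzOnWith.continuousOn (K := K.toNNReal) ?_
  refine LipschitzOnWith.of_dist_le_mul fun z hz w hw => ?_
  rw [dist_eq_norm, dist_eq_norm, Real.coe_toNNReal _ hK.le]
  exact hL z w hz hw

/-- The quantity `‖z - w‖² / (depth z * depth w)`, a function of the hyperbolic distance in the
disc, does not increase under `f`; it decreases by a fixed factor if one of the
points is bounded away from `A`. -/
lemma rel_map (h : TangentContraction m lam D v A f d) (hlam : 0 < lam) {c : ℝ} (hc : 0 ≤ c)
    {B : ℝ} (hB : 0 ≤ B) {z w : ℂ} (hz : 0 ≤ depth m lam z) (hw : 0 ≤ depth m lam w)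
    (hcz : c ≤ ‖z - A‖ ^ 2)
    (hzw : ‖z - w‖ ^ 2 ≤ B * (depth m lam z * depth m lam w)) :
    ‖f z - f w‖ ^ 2 ≤ (1 + v * c / (D * lam ^ 2))⁻¹ * B *
      (depth m lam (f z) * depth m lam (f w)) := by
  have hD := h.D_pos
  have hv := h.v_pos
  have hdz := h.d_pos z hz
  have hdw := h.d_pos w hw
  set t := v * c / (D * lam ^ 2) with ht
  have ht0 : 0 ≤ t := by positivity
  have hx : ∀ x, 0 ≤ depth m lam x → c ≤ ‖x - A‖ ^ 2 →
      D * (1 + t) * depth m lam x ≤ D * depth m lam x + v * ‖x - A‖ ^ 2 := by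
    intro x hx hcx
    have h1 : D * t * depth m lam x ≤ D * t * lam ^ 2 := by
      gcongr; exact depth_le x
    have h2 : D * t * lam ^ 2 = v * c := by rw [ht]; field_simp
    have h3 : v * c ≤ v * ‖x - A‖ ^ 2 := by gcongr
    linarith
  have hmain : D ^ 2 * ‖z - w‖ ^ 2 ≤ (1 + t)⁻¹ * B *
      ((D * depth m lam z + v * ‖z - A‖ ^ 2) * (D * depth m lam w + v * ‖w - A‖ ^ 2)) := by
    calc D ^ 2 * ‖z - w‖ ^ 2 ≤ D ^ 2 * (B * (depth m lam z * depth m lam w)) := by gcongr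
      _ = (1 + t)⁻¹ * B * ((D * (1 + t) * depth m lam z) * (D * depth m lam w)) := by
        field_simp
      _ ≤ _ := by
        refine mul_le_mul_of_nonneg_left (mul_le_mul (hx z hz hcz) ?_ ?_ ?_) (by positivity)
        · nlinarith [sq_nonneg ‖w - A‖]
        · positivity
        · positivity
  rw [← h.depth_map z hz, ← h.depth_map w hw, ← h.dist_map z w hz hw] at hmain
  have hdd : 0 < d z * d w := by positivity
  refine le_of_mul_le_mul_right ?_ hdd
  calc _ ≤ _ := hmain
    _ = _ := by ring

/-- Iterating `f` shrinks the disc to the fixed point: the horodiscs at `A` that contain the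
images have curvature growing at least linearly. -/
lemma iterate_bound (h : TangentContraction m lam D v A f d) {z : ℂ}
    (hz : 0 ≤ depth m lam z) (n : ℕ) :
    0 ≤ depth m lam (f^[n] z) ∧
      n * (v * d A / D ^ 2) * ‖f^[n] z - A‖ ^ 2 ≤ depth m lam (f^[n] z) := by
  have hD := h.D_pos
  have hv := h.v_pos
  have hdA := h.d_pos A h.depth_tip.ge
  induction n with
  | zero => simpa using hz
  | succ n ih =>
    obtain ⟨hn, hi⟩ := ih
    rw [Function.iterate_succ_apply']
    set y := f^[n] z
    refine ⟨h.depth_map_nonneg hn, ?_⟩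
    have hdy := h.d_pos y hn
    have h1 := h.dist_map y A hn h.depth_tip.ge
    rw [h.fixed] at h1
    have h2 := h.depth_map y hn
    refine le_of_mul_le_mul_right ?_ hdy
    rw [h2]
    have h3 : ‖f y - A‖ ^ 2 * d y = D ^ 2 * ‖y - A‖ ^ 2 / d A := by
      rw [eq_div_iff hdA.ne', ← h1]; ring
    have h4 : (n + 1 : ℝ) * (v * d A / D ^ 2) * ‖f y - A‖ ^ 2 * d y
        = (n + 1) * v * ‖y - A‖ ^ 2 := by
      rw [mul_assoc, h3]; field_simp
    push_cast
    rw [h4]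
    have h5 : (n : ℝ) * v * ‖y - A‖ ^ 2 ≤ D * (n * (v * d A / D ^ 2) * ‖y - A‖ ^ 2) := by
      have : D * (n * (v * d A / D ^ 2) * ‖y - A‖ ^ 2) = n * v * ‖y - A‖ ^ 2 * (d A / D) := by
        field_simp
      rw [this]
      exact le_mul_of_one_le_right (by positivity) ((one_le_div hD).2 h.D_le)
    nlinarith

lemma iterate_small (h : TangentContraction m lam D v A f d) {ε : ℝ} (hε : 0 < ε) :
    ∃ n : ℕ, ∀ z, 0 ≤ depth m lam z → ‖f^[n] z - A‖ < ε := by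
  have hD := h.D_pos
  have hv := h.v_pos
  have hdA := h.d_pos A h.depth_tip.ge
  have hη : 0 < v * d A / D ^ 2 * ε ^ 2 := by positivity
  obtain ⟨n, hn⟩ := exists_nat_gt (lam ^ 2 / (v * d A / D ^ 2 * ε ^ 2))
  rw [div_lt_iff₀ hη] at hn
  refine ⟨n, fun z hz => ?_⟩
  by_contra! hcon
  have h1 := (h.iterate_bound hz n).2
  have h2 : (n : ℝ) * (v * d A / D ^ 2) * ε ^ 2 ≤ n * (v * d A / D ^ 2) * ‖f^[n] z - A‖ ^ 2 := by
    gcongr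
  have := depth_le (m := m) (lam := lam) (f^[n] z)
  nlinarith

end TangentContraction

/-- The composition `F x₁ ∘ ⋯ ∘ F xₙ` along a finite binary word. -/
def wordMap (F : Bool → ℂ → ℂ) : List Bool → ℂ → ℂ
  | [] => id
  | b :: l => F b ∘ wordMap F l

variable {A : Bool → ℂ} {F : Bool → ℂ → ℂ} {d : Bool → ℂ → ℝ}

lemma depth_wordMap_nonneg (h : ∀ b, TangentContraction m lam D v (A b) (F b) (d b))
    (l : List Bool) {z : ℂ} (hz : 0 ≤ depth m lam z) : 0 ≤ depth m lam (wordMap F l z) := by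
  induction l with
  | nil => simpa [wordMap] using hz
  | cons b l ih => exact (h b).depth_map_nonneg ih

/-- The images of the two maps stay away from each other's tips. -/
lemma exists_gap (h : ∀ b, TangentContraction m lam D v (A b) (F b) (d b)) (hlam : 0 ≤ lam)
    (hA : A true ≠ A false) :
    ∃ c > 0, ∀ b z, 0 ≤ depth m lam z → c ≤ ‖F (!b) z - A b‖ ^ 2 := by
  have hne : ∀ b, A (!b) ≠ A b := by rintro (_ | _); exacts [hA, hA.symm]
  have key : ∀ b, ∃ c > 0, ∀ z, 0 ≤ depth m lam z → c ≤ ‖F (!b) z - A b‖ ^ 2 := by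
    intro b
    have hcont : ContinuousOn (fun z => ‖F (!b) z - A b‖ ^ 2) {z | 0 ≤ depth m lam z} :=
      (((h (!b)).continuousOn hlam).sub continuousOn_const).norm.pow 2
    obtain ⟨z₀, hz₀, hmin⟩ := (isCompact_depth_nonneg (m := m) hlam).exists_isMinOn
      ⟨A b, (h b).depth_tip.ge⟩ hcont
    refine ⟨_, ?_, fun z hz => hmin hz⟩
    have : F (!b) z₀ ≠ A b := by
      intro heq
      by_cases hz : z₀ = A (!b)
      · rw [hz, (h (!b)).fixed] at heq
        exact hne b heq
      · have := (h (!b)).depth_map_pos hz₀ hz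
        rw [heq, (h b).depth_tip] at this
        exact this.false
    have : 0 < ‖F (!b) z₀ - A b‖ := norm_pos_iff.2 (sub_ne_zero.2 this)
    positivity
  obtain ⟨c₁, h1, h1'⟩ := key true
  obtain ⟨c₂, h2, h2'⟩ := key false
  refine ⟨min c₁ c₂, lt_min h1 h2, ?_⟩
  rintro (_ | _) z hz
  exacts [(min_le_right _ _).trans (h2' z hz), (min_le_left _ _).trans (h1' z hz)]

/-- After a change of letter the disc is mapped into a smaller concentric disc. -/
lemma exists_depth_bound (h : ∀ b, TangentContraction m lam D v (A b) (F b) (d b))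
    (hlam : 0 ≤ lam) (hA : A true ≠ A false) :
    ∃ n₀ > 0, ∀ b z, 0 ≤ depth m lam z → n₀ ≤ depth m lam (F b (F (!b) z)) := by
  obtain ⟨c, hc, hgap⟩ := exists_gap h hlam hA
  have key : ∀ b, ∃ n₀ > 0, ∀ z, 0 ≤ depth m lam z → n₀ ≤ depth m lam (F b (F (!b) z)) := by
    intro b
    obtain ⟨z₁, hz₁, hmax⟩ := (isCompact_depth_nonneg (m := m) hlam).exists_isMaxOn
      ⟨A b, (h b).depth_tip.ge⟩ (h b).d_cont.continuousOn
    have hM := (h b).d_pos z₁ hz₁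
    have hv := (h b).v_pos
    have hD := (h b).D_pos
    refine ⟨v * c / d b z₁, by positivity, fun z hz => ?_⟩
    have hy := (h (!b)).depth_map_nonneg hz
    have h1 := (h b).depth_map _ hy
    have h2 : d b (F (!b) z) ≤ d b z₁ := hmax hy
    have h3 := (h b).depth_map_nonneg hy
    rw [div_le_iff₀ hM]
    have h4 : v * c ≤ v * ‖F (!b) z - A b‖ ^ 2 := by gcongr; exact hgap b z hz
    have h5 : depth m lam (F b (F (!b) z)) * d b (F (!b) z) ≤
      depth m lam (F b (F (!b) z)) * d b z₁ := by gcongr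
    nlinarith [mul_nonneg hD.le hy]
  obtain ⟨c₁, h1, h1'⟩ := key true
  obtain ⟨c₂, h2, h2'⟩ := key false
  refine ⟨min c₁ c₂, lt_min h1 h2, ?_⟩
  rintro (_ | _) z hz
  exacts [(min_le_right _ _).trans (h2' z hz), (min_le_left _ _).trans (h1' z hz)]

/-- The map along the word `l` takes the disc to a set in which any two points satisfy
`‖z - w‖² ≤ B * (depth z * depth w)`; this bounds its hyperbolic diameter. -/
def Contracts (m lam : ℝ) (F : Bool → ℂ → ℂ) (B : ℝ) (l : List Bool) : Prop :=
  ∀ z w, 0 ≤ depth m lam z → 0 ≤ depth m lam w →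
    ‖wordMap F l z - wordMap F l w‖ ^ 2 ≤
      B * (depth m lam (wordMap F l z) * depth m lam (wordMap F l w))

lemma Contracts.cons (h : ∀ b, TangentContraction m lam D v (A b) (F b) (d b)) (hlam : 0 < lam)
    {B : ℝ} (hB : 0 ≤ B) {l : List Bool} (hl : Contracts m lam F B l) (b : Bool) :
    Contracts m lam F B (b :: l) := by
  intro z w hz hw
  have := (h b).rel_map hlam le_rfl hB (depth_wordMap_nonneg h l hz)
    (depth_wordMap_nonneg h l hw) (sq_nonneg _) (hl z w hz hw)
  simpa [wordMap] using this

/-- At a change of letter the constant improves by a fixed factor, since the image of the inner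
map stays away from the tip of the outer one. -/
lemma Contracts.cons_cons (h : ∀ b, TangentContraction m lam D v (A b) (F b) (d b))
    (hlam : 0 < lam) {c : ℝ} (hc : 0 ≤ c)
    (hgap : ∀ b z, 0 ≤ depth m lam z → c ≤ ‖F (!b) z - A b‖ ^ 2)
    {B : ℝ} (hB : 0 ≤ B) {l : List Bool} (b : Bool) (hl : Contracts m lam F B ((!b) :: l)) :
    Contracts m lam F ((1 + v * c / (D * lam ^ 2))⁻¹ * B) (b :: (!b) :: l) := fun z w hz hw =>
  (h b).rel_map hlam hc hB (depth_wordMap_nonneg h _ hz) (depth_wordMap_nonneg h _ hw)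
    (hgap b _ (depth_wordMap_nonneg h l hz))
    (hl z w hz hw)

lemma norm_sub_sq_le {z w : ℂ} (hz : 0 ≤ depth m lam z) (hw : 0 ≤ depth m lam w) :
    ‖z - w‖ ^ 2 ≤ 4 * lam ^ 2 := by
  have h1 : ‖z - w‖ ≤ ‖z - m‖ + ‖w - m‖ := by
    rw [norm_sub_rev w]; exact norm_sub_le_norm_sub_add_norm_sub _ _ _
  unfold depth at hz hw
  nlinarith [norm_nonneg (z - w), sq_nonneg (‖z - m‖ - ‖w - m‖)]

lemma contracts_of_switch (h : ∀ b, TangentContraction m lam D v (A b) (F b) (d b))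
    {n₀ : ℝ} (hn₀ : 0 < n₀) (hdep : ∀ b z, 0 ≤ depth m lam z → n₀ ≤ depth m lam (F b (F (!b) z)))
    (l : List Bool) (b : Bool) :
    Contracts m lam F (4 * lam ^ 2 / n₀ ^ 2) (b :: (!b) :: l) := by
  intro z w hz hw
  refine (norm_sub_sq_le (depth_wordMap_nonneg h _ hz) (depth_wordMap_nonneg h _ hw)).trans ?_
  have h1 : n₀ ≤ depth m lam (wordMap F (b :: (!b) :: l) z) :=
    hdep b _ (depth_wordMap_nonneg h l hz)
  have h2 : n₀ ≤ depth m lam (wordMap F (b :: (!b) :: l) w) :=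
    hdep b _ (depth_wordMap_nonneg h l hw)
  rw [div_mul_eq_mul_div, le_div_iff₀ (by positivity), pow_two n₀]
  exact mul_le_mul_of_nonneg_left (mul_le_mul h1 h2 hn₀.le (hn₀.le.trans h1)) (by positivity)

lemma initial_succ (x : ℕ → Bool) (n : ℕ) :
    initial x (n + 1) = x 0 :: initial (fun k => x (k + 1)) n := by
  simp [initial, List.ofFn_succ]

lemma contracts_of_shift (h : ∀ b, TangentContraction m lam D v (A b) (F b) (d b))
    (hlam : 0 < lam) {B : ℝ} (hB : 0 ≤ B) (i : ℕ) (x : ℕ → Bool) {n : ℕ}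
    (hl : Contracts m lam F B (initial (fun k => x (k + i)) n)) :
    Contracts m lam F B (initial x (n + i)) := by
  induction i generalizing x with
  | zero => simpa using hl
  | succ i ih =>
    rw [← add_assoc, initial_succ]
    refine Contracts.cons h hlam hB (ih _ ?_) _
    simpa only [add_assoc] using hl

/-- If the letters of `x` change infinitely often then the constants tend to zero
geometrically. -/
lemma exists_contracts (h : ∀ b, TangentContraction m lam D v (A b) (F b) (d b))
    (hlam : 0 < lam) (hA : A true ≠ A false) :
    ∃ κ B : ℝ, 0 ≤ κ ∧ κ < 1 ∧ 0 ≤ B ∧ ∀ (j : ℕ) (x : ℕ → Bool),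
      (∀ N, ∃ i ≥ N, x i ≠ x (i + 1)) →
      ∃ n, Contracts m lam F (κ ^ j * B) (initial x (n + 1)) := by
  obtain ⟨c, hc, hgap⟩ := exists_gap h hlam.le hA
  obtain ⟨n₀, hn₀, hdep⟩ := exists_depth_bound h hlam.le hA
  have hD := (h true).D_pos
  have hv := (h true).v_pos
  have hpos : 0 < v * c / (D * lam ^ 2) := by positivity
  refine ⟨(1 + v * c / (D * lam ^ 2))⁻¹, 4 * lam ^ 2 / n₀ ^ 2, by positivity,
    inv_lt_one_of_one_lt₀ (by linarith), by positivity, fun j => ?_⟩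
  induction j with
  | zero =>
    intro x hx
    obtain ⟨i, -, hi⟩ := hx 0
    refine ⟨i + 1, ?_⟩
    rw [show i + 1 + 1 = 2 + i by ring]
    refine contracts_of_shift h hlam (by positivity) i x ?_
    have hi' : x (0 + 1 + i) = !(x (0 + i)) := by
      rw [show 0 + 1 + i = i + 1 by ring, zero_add]
      cases h1 : x i <;> cases h2 : x (i + 1) <;> simp_all
    rw [initial_succ, initial_succ, hi', pow_zero, one_mul]
    exact contracts_of_switch h hn₀ hdep _ _
  | succ j ih =>
    intro x hx
    obtain ⟨i, -, hi⟩ := hx 0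
    obtain ⟨n, hn⟩ := ih (fun k => x (k + (i + 1))) fun N => by
      obtain ⟨i', h1, h2⟩ := hx (N + (i + 1))
      refine ⟨i' - (i + 1), by omega, ?_⟩
      simpa only [show i' - (i + 1) + (i + 1) = i' by omega,
        show i' - (i + 1) + 1 + (i + 1) = i' + 1 by omega] using h2
    refine ⟨n + 1 + i, ?_⟩
    rw [show n + 1 + i + 1 = n + 1 + 1 + i by ring]
    refine contracts_of_shift h hlam (by positivity) i x ?_
    have hi' : x (0 + (i + 1)) = !(x (0 + i)) := by
      rw [zero_add, zero_add]
      cases h1 : x i <;> cases h2 : x (i + 1) <;> simp_all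
    rw [initial_succ] at hn
    simp only [hi'] at hn
    rw [initial_succ, initial_succ, pow_succ', mul_assoc]
    have hi2 : x (0 + 1 + i) = !(x (0 + i)) := by rw [← hi']; congr 1; ring
    rw [hi2]
    refine Contracts.cons_cons h hlam hc.le hgap (by positivity) _ ?_
    convert hn using 5
    ring

/-- Along every infinite word the images of the disc shrink. -/
theorem exists_wordMap_small (h : ∀ b, TangentContraction m lam D v (A b) (F b) (d b))
    (hlam : 0 < lam) (hA : A true ≠ A false) (x : ℕ → Bool) {ε : ℝ} (hε : 0 < ε) :
    ∃ n, ∀ z w, 0 ≤ depth m lam z → 0 ≤ depth m lam w →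
      ‖wordMap F (initial x n) z - wordMap F (initial x n) w‖ < ε := by
  by_cases hx : ∀ N, ∃ i ≥ N, x i ≠ x (i + 1)
  · obtain ⟨κ, B, hκ0, hκ1, hB, hcon⟩ := exists_contracts h hlam hA
    have hlim : Filter.Tendsto (fun j => κ ^ j * B * lam ^ 4) Filter.atTop (nhds 0) := by
      simpa using ((tendsto_pow_atTop_nhds_zero_of_lt_one hκ0 hκ1).mul_const B).mul_const (lam ^ 4)
    obtain ⟨j, hj⟩ := (hlim.eventually (gt_mem_nhds (by positivity : 0 < ε ^ 2))).exists
    obtain ⟨n, hn⟩ := hcon j x hx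
    refine ⟨n + 1, fun z w hz hw => ?_⟩
    have h1 := hn z w hz hw
    set z' := wordMap F (initial x (n + 1)) z
    set w' := wordMap F (initial x (n + 1)) w
    have h2 : depth m lam z' * depth m lam w' ≤ lam ^ 4 := by
      have := mul_le_mul (depth_le (m := m) z') (depth_le (m := m) w')
        (depth_wordMap_nonneg h _ hw) (sq_nonneg lam)
      nlinarith
    have h3 : κ ^ j * B * (depth m lam z' * depth m lam w') ≤ κ ^ j * B * lam ^ 4 := by gcongr
    exact lt_of_pow_lt_pow_left₀ 2 hε.le (by linarith)
  · push Not at hx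
    obtain ⟨N, hN⟩ := hx
    induction N generalizing x ε with
    | zero =>
      have hconst : ∀ i, x i = x 0 := by
        intro i
        induction i with
        | zero => rfl
        | succ i ih => rw [← hN i (Nat.zero_le _), ih]
      have hx : x = fun _ => x 0 := funext hconst
      have hword : ∀ b n, wordMap F (initial (fun _ => b) n) = (F b)^[n] := by
        intro b n
        induction n with
        | zero => simp [initial, wordMap]
        | succ n ih => rw [initial_succ, wordMap, ih, Function.iterate_succ']
      obtain ⟨n, hn⟩ := (h (x 0)).iterate_small (half_pos hε)
      refine ⟨n, fun z w hz hw => ?_⟩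
      rw [hx, hword]
      calc ‖(F (x 0))^[n] z - (F (x 0))^[n] w‖
          ≤ ‖(F (x 0))^[n] z - A (x 0)‖ + ‖A (x 0) - (F (x 0))^[n] w‖ :=
            norm_sub_le_norm_sub_add_norm_sub _ _ _
        _ < ε := by
          rw [norm_sub_rev (A (x 0))]
          linarith [hn z hz, hn w hw]
    | succ N ih =>
      obtain ⟨K, hK, hL⟩ := (h (x 0)).exists_lipschitz hlam.le
      obtain ⟨n, hn⟩ := ih (fun k => x (k + 1)) (div_pos hε hK)
        fun i hi => hN (i + 1) (by omega)
      refine ⟨n + 1, fun z w hz hw => ?_⟩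
      rw [initial_succ]
      have h1 := hn z w hz hw
      rw [lt_div_iff₀ hK] at h1
      refine (hL _ _ (depth_wordMap_nonneg h _ hz) (depth_wordMap_nonneg h _ hw)).trans_lt ?_
      linarith

end

/-! ### The closed triangle -/

lemma triangle_subset_closedBall {φ ψ R : ℝ} {c : ℂ} (hR : 0 ≤ R)
    (hE : edges φ ψ ⊆ Metric.closedBall c R) : triangle φ ψ ⊆ Metric.closedBall c R := by
  refine closure_minimal (fun z hz => ?_) Metric.isClosed_closedBall
  by_contra hzR
  rw [Metric.mem_closedBall, dist_eq_norm, not_le] at hzR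
  have hpos : 0 < ‖z - c‖ := hR.trans_lt hzR
  -- the ray from `z` pointing away from `c` misses the edges
  let s : Set ℂ := (fun t : ℝ => c + t • (z - c)) '' Set.Ici 1
  have hs : IsPreconnected s := isPreconnected_Ici.image _ (by fun_prop)
  have hnorm : ∀ t : ℝ, 1 ≤ t → ‖c + t • (z - c) - c‖ = t * ‖z - c‖ := fun t ht => by
    rw [add_sub_cancel_left, norm_smul, Real.norm_of_nonneg (by linarith)]
  have hsE : s ⊆ (edges φ ψ)ᶜ := by
    rintro _ ⟨t, ht, rfl⟩ hmem
    have h1 := hE hmem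
    rw [Metric.mem_closedBall, dist_eq_norm, hnorm t ht] at h1
    have : 1 * ‖z - c‖ ≤ t * ‖z - c‖ := by gcongr; exact ht
    linarith
  have hzs : z ∈ s := ⟨1, Set.self_mem_Ici, by simp⟩
  obtain ⟨M, hM⟩ := (hz.2.subset (hs.subset_connectedComponentIn hzs hsE)).subset_closedBall c
  have ht : (1 : ℝ) ≤ 1 + |M| / ‖z - c‖ := by
    have : 0 ≤ |M| / ‖z - c‖ := by positivity
    linarith
  have h2 := hM ⟨_, ht, rfl⟩
  rw [Metric.mem_closedBall, dist_eq_norm, hnorm _ ht, add_mul, div_mul_cancel₀ _ hpos.ne'] at h2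
  linarith [le_abs_self M]

/-- A bounded open set that misses the edges and whose frontier lies in the edges is made of
bounded components of their complement. -/
lemma subset_openTriangle {φ ψ : ℝ} {W : Set ℂ} (ho : IsOpen W) (hb : Bornology.IsBounded W)
    (hd : Disjoint W (edges φ ψ)) (hf : frontier W ⊆ edges φ ψ) : W ⊆ openTriangle φ ψ := by
  intro z hz
  have hzE : z ∈ (edges φ ψ)ᶜ := Set.disjoint_left.1 hd hz
  refine ⟨hzE, hb.subset ?_⟩
  refine isPreconnected_connectedComponentIn.subset_left_of_subset_union ho
    isClosed_closure.isOpen_compl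
    (disjoint_compl_right.mono_right (Set.compl_subset_compl.2 subset_closure)) ?_
    ⟨z, mem_connectedComponentIn hzE, hz⟩
  intro w hw
  by_cases hwW : w ∈ W
  · exact Or.inl hwW
  · refine Or.inr fun hcl => connectedComponentIn_subset _ _ hw (hf ?_)
    rw [ho.frontier_eq]
    exact ⟨hcl, hwW⟩

/-! ### Coordinates of the vertices and edges -/

/-- The point `r e^{iψ}`. -/
def apex (φ ψ : ℝ) : ℂ := radius φ ψ * Complex.exp (ψ * Complex.I)

@[simp] lemma vertexPlus_re (φ : ℝ) : (vertexPlus φ).re = Real.cos φ := by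
  simp [vertexPlus, Complex.exp_ofReal_mul_I_re]

@[simp] lemma vertexPlus_im (φ : ℝ) : (vertexPlus φ).im = Real.sin φ := by
  simp [vertexPlus, Complex.exp_ofReal_mul_I_im]

lemma vertexMinus_eq_conj (φ : ℝ) : vertexMinus φ = conj (vertexPlus φ) := by
  simp [vertexMinus, vertexPlus, ← Complex.exp_conj]

@[simp] lemma vertexMinus_re (φ : ℝ) : (vertexMinus φ).re = Real.cos φ := by
  simp [vertexMinus_eq_conj]

@[simp] lemma vertexMinus_im (φ : ℝ) : (vertexMinus φ).im = -Real.sin φ := by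
  simp [vertexMinus_eq_conj]

lemma apex_re (φ ψ : ℝ) : (apex φ ψ).re = radius φ ψ * Real.cos ψ := by
  simp [apex, Complex.exp_ofReal_mul_I_re]

lemma apex_im (φ ψ : ℝ) : (apex φ ψ).im = radius φ ψ * Real.sin ψ := by
  simp [apex, Complex.exp_ofReal_mul_I_im]

lemma cos_half_pos {φ : ℝ} (hφ : φ ∈ Set.Ioo 0 Real.pi) : 0 < Real.cos (φ / 2) :=
  Real.cos_pos_of_mem_Ioo ⟨by linarith [hφ.1, Real.pi_pos], by linarith [hφ.2]⟩

lemma sin_half_pos {φ : ℝ} (hφ : φ ∈ Set.Ioo 0 Real.pi) : 0 < Real.sin (φ / 2) :=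
  Real.sin_pos_of_pos_of_lt_pi (by linarith [hφ.1]) (by linarith [hφ.1, hφ.2])

lemma cos_eq_half (φ : ℝ) : Real.cos φ = 2 * Real.cos (φ / 2) ^ 2 - 1 := by
  rw [← Real.cos_two_mul]; congr 1; ring

lemma sin_eq_half (φ : ℝ) : Real.sin φ = 2 * Real.sin (φ / 2) * Real.cos (φ / 2) := by
  rw [← Real.sin_two_mul]; congr 1; ring

lemma sin_sub_half_ne_zero {φ ψ : ℝ} (hφ : φ ∈ Set.Ioo 0 Real.pi) (hψ : ψ ∈ Set.Icc 0 Real.pi)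
    (h : ψ ≠ φ / 2) : Real.sin (ψ - φ / 2) ≠ 0 := by
  have := hφ.1; have := hφ.2; have := hψ.1; have := hψ.2
  rcases lt_or_gt_of_ne h with h | h
  · exact (Real.sin_neg_of_neg_of_neg_pi_lt (by linarith) (by linarith)).ne
  · exact (Real.sin_pos_of_pos_of_lt_pi (by linarith) (by linarith)).ne'

lemma sin_add_ne_zero {φ ψ : ℝ} (hφ : φ ∈ Set.Ioo 0 Real.pi) (hψ : ψ ∈ Set.Icc 0 Real.pi)
    (h : φ + ψ ≠ Real.pi) : Real.sin (φ + ψ) ≠ 0 := by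
  have := hφ.1; have := hφ.2; have := hψ.1; have := hψ.2
  rcases lt_or_gt_of_ne h with h | h
  · exact (Real.sin_pos_of_pos_of_lt_pi (by linarith) (by linarith)).ne'
  · rw [← Real.sin_sub_two_pi]
    exact (Real.sin_neg_of_neg_of_neg_pi_lt (by linarith) (by linarith)).ne

lemma apex_re_sub {φ ψ : ℝ} (hφ : φ ∈ Set.Ioo 0 Real.pi) :
    (apex φ ψ).re - Real.cos φ =
      -(Real.sin (φ + ψ) * Real.sin (ψ - φ / 2)) / Real.cos (φ / 2) := by
  have hc := (cos_half_pos hφ).ne'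
  rw [apex_re, radius, eq_div_iff hc, sub_mul, div_mul_eq_mul_div, div_mul_cancel₀ _ hc,
    show φ + ψ = φ / 2 + φ / 2 + ψ by ring, cos_eq_half φ]
  simp only [Real.cos_add, Real.sin_add, Real.sin_sub]
  have h1 := Real.sin_sq_add_cos_sq (φ / 2)
  have h2 := Real.sin_sq_add_cos_sq ψ
  set c := Real.cos (φ / 2)
  set s := Real.sin (φ / 2)
  have h3 : s ^ 2 = 1 - c ^ 2 := by linarith
  have h4 : Real.sin ψ ^ 2 = 1 - Real.cos ψ ^ 2 := by linarith
  ring_nf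
  have h5 : s ^ 3 = s * (1 - c ^ 2) := by rw [← h3]; ring
  simp only [h3, h4, h5]
  ring

/-- The centre of the circle through `A₊`, `A₋` and `r e^{iψ}`, a point of the real axis. -/
def arcCentre (φ ψ : ℝ) : ℝ := Real.sin ψ / (2 * Real.cos (φ / 2) * Real.sin (ψ - φ / 2))

lemma normSq_apex_sub {φ ψ : ℝ} (hφ : φ ∈ Set.Ioo 0 Real.pi) :
    Complex.normSq (apex φ ψ) - 1 =
      -(Real.sin (φ + ψ) * Real.sin ψ) / Real.cos (φ / 2) ^ 2 := by
  have hc := (cos_half_pos hφ).ne'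
  have h2 := Real.sin_sq_add_cos_sq ψ
  have h1 := Real.sin_sq_add_cos_sq (φ / 2)
  have hr : Complex.normSq (apex φ ψ) = radius φ ψ ^ 2 := by
    rw [Complex.normSq_apply, apex_re, apex_im]
    linear_combination radius φ ψ ^ 2 * h2
  rw [hr, radius, eq_div_iff (pow_ne_zero 2 hc), sub_mul, div_pow,
    div_mul_cancel₀ _ (pow_ne_zero 2 hc), show φ + ψ = φ / 2 + φ / 2 + ψ by ring]
  simp only [Real.cos_add, Real.sin_add]
  set c := Real.cos (φ / 2)
  set s := Real.sin (φ / 2)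
  have h3 : s ^ 2 = 1 - c ^ 2 := by linarith
  have h4 : Real.sin ψ ^ 2 = 1 - Real.cos ψ ^ 2 := by linarith
  ring_nf
  simp only [h3, h4]
  ring

lemma apex_on_circle {φ ψ : ℝ} (hφ : φ ∈ Set.Ioo 0 Real.pi) (hψ : ψ ∈ Set.Icc 0 Real.pi)
    (h : ψ ≠ φ / 2) : Complex.normSq (apex φ ψ) - 1 =
      2 * arcCentre φ ψ * ((apex φ ψ).re - Real.cos φ) := by
  have hc := (cos_half_pos hφ).ne'
  have hs := sin_sub_half_ne_zero hφ hψ h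
  rw [normSq_apex_sub hφ, apex_re_sub hφ, arcCentre]
  set x := Real.sin (ψ - φ / 2)
  field_simp

lemma mem_line_vertices {φ y : ℝ} (hS : Real.sin φ ≠ 0) :
    (⟨Real.cos φ, y⟩ : ℂ) ∈ line[ℝ, vertexPlus φ, vertexMinus φ] := by
  have : (⟨Real.cos φ, y⟩ : ℂ) =
      AffineMap.lineMap (vertexPlus φ) (vertexMinus φ) ((1 - y / Real.sin φ) / 2) := by
    apply Complex.ext
    · rw [AffineMap.lineMap_apply, vsub_eq_sub, vadd_eq_add, Complex.add_re, Complex.smul_re,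
        Complex.sub_re, vertexPlus_re, vertexMinus_re]
      simp
    · rw [AffineMap.lineMap_apply, vsub_eq_sub, vadd_eq_add, Complex.add_im, Complex.smul_im,
        Complex.sub_im, vertexPlus_im, vertexMinus_im, smul_eq_mul]
      field_simp
      ring
  rw [this]
  exact AffineMap.lineMap_mem_affineSpan_pair _ _ _

lemma re_of_mem_line {φ : ℝ} {z : ℂ} (h : z ∈ line[ℝ, vertexPlus φ, vertexMinus φ]) :
    z.re = Real.cos φ := by
  obtain ⟨t, rfl⟩ := mem_affineSpan_pair_iff_exists_lineMap_eq.1 h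
  simp [AffineMap.lineMap_apply]

lemma wSameSide_iff {φ : ℝ} (hS : Real.sin φ ≠ 0) {z q : ℂ} (hq : q.re ≠ Real.cos φ) :
    (line[ℝ, vertexPlus φ, vertexMinus φ]).WSameSide z q ↔
      0 ≤ (z.re - Real.cos φ) * (q.re - Real.cos φ) := by
  have hq' : q.re - Real.cos φ ≠ 0 := sub_ne_zero.2 hq
  constructor
  · rintro ⟨p₁, h₁, p₂, h₂, hr⟩
    have h3 := hr.map Complex.reLm
    simp only [vsub_eq_sub, Complex.reLm_coe, Complex.sub_re, re_of_mem_line h₁,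
      re_of_mem_line h₂] at h3
    rcases h3 with h | h | ⟨a, b, ha, hb, h⟩
    · simp [h]
    · simp [h]
    · simp only [smul_eq_mul] at h
      have : a * ((z.re - Real.cos φ) * (q.re - Real.cos φ)) =
          b * (q.re - Real.cos φ) ^ 2 := by rw [← mul_assoc, h]; ring
      exact nonneg_of_mul_nonneg_right (this ▸ by positivity) ha
  · intro h
    refine ⟨_, mem_line_vertices (y := z.im) hS, _, mem_line_vertices (y := q.im) hS, ?_⟩
    have h1 : z -ᵥ (⟨Real.cos φ, z.im⟩ : ℂ) =
        ((z.re - Real.cos φ) / (q.re - Real.cos φ)) • (q -ᵥ (⟨Real.cos φ, q.im⟩ : ℂ)) := by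
      apply Complex.ext
      · rw [Complex.smul_re, smul_eq_mul, vsub_eq_sub, vsub_eq_sub, Complex.sub_re, Complex.sub_re,
          div_mul_cancel₀ _ hq']
      · rw [Complex.smul_im, vsub_eq_sub, vsub_eq_sub, Complex.sub_im, Complex.sub_im]
        simp
    rw [h1]
    refine SameRay.sameRay_nonneg_smul_left _ ?_
    have : 0 < (q.re - Real.cos φ) ^ 2 := by positivity
    calc (0:ℝ) ≤ _ := div_nonneg h this.le
      _ = _ := by field_simp

/-- The arc `s₀` consists of the points of its circle on one closed side of the line `A₊A₋`. -/
lemma mem_edgeZero_iff {φ ψ : ℝ} (hφ : φ ∈ Set.Ioo 0 Real.pi) (hψ : ψ ∈ Set.Icc 0 Real.pi)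
    (hφψ : φ + ψ ≠ Real.pi) (h : ψ ≠ φ / 2) (z : ℂ) :
    z ∈ edgeZero φ ψ ↔
      Complex.normSq z - 1 = 2 * arcCentre φ ψ * (z.re - Real.cos φ) ∧
        0 ≤ (z.re - Real.cos φ) * -(Real.sin (φ + ψ) * Real.sin (ψ - φ / 2)) := by
  have hS : Real.sin φ ≠ 0 := (Real.sin_pos_of_pos_of_lt_pi hφ.1 hφ.2).ne'
  have hc := cos_half_pos hφ
  have hqr := apex_re_sub (ψ := ψ) hφ
  have hq0 : (apex φ ψ).re - Real.cos φ ≠ 0 := by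
    rw [hqr]
    exact div_ne_zero (neg_ne_zero.2 (mul_ne_zero (sin_add_ne_zero hφ hψ hφψ)
      (sin_sub_half_ne_zero hφ hψ h))) hc.ne'
  have hqc := apex_on_circle hφ hψ h
  have hsc := Real.sin_sq_add_cos_sq φ
  rw [edgeZero, if_neg h, circArc, Set.mem_ofPred_eq, ← apex,
    wSameSide_iff hS (sub_ne_zero.1 hq0), hqr, ← mul_div_assoc, div_nonneg_iff]
  have hside : ∀ x : ℝ, (0 ≤ x ∧ 0 ≤ Real.cos (φ / 2) ∨ x ≤ 0 ∧ Real.cos (φ / 2) ≤ 0) ↔ 0 ≤ x :=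
    fun x => ⟨by rintro (⟨h, -⟩ | ⟨-, h⟩); exacts [h, absurd h hc.not_ge],
      fun h => Or.inl ⟨h, hc.le⟩⟩
  rw [hside]
  refine and_congr_left fun _ => ?_
  rw [Complex.normSq_apply] at hqc ⊢
  have hsq : ∀ x y : ℂ, dist x y ^ 2 = (x.re - y.re) ^ 2 + (x.im - y.im) ^ 2 := fun x y => by
    rw [dist_eq_norm, ← Complex.normSq_eq_norm_sq, Complex.normSq_apply]; simp; ring
  constructor
  · rintro ⟨o, R, ho⟩
    have h1 := congrArg (· ^ 2) (ho (vertexPlus φ) (by simp))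
    have h2 := congrArg (· ^ 2) (ho (vertexMinus φ) (by simp))
    have h3 := congrArg (· ^ 2) (ho (apex φ ψ) (by simp))
    have h4 := congrArg (· ^ 2) (ho z (by simp))
    simp only [hsq, vertexPlus_re, vertexPlus_im, vertexMinus_re, vertexMinus_im] at h1 h2 h3 h4
    have h5 : o.im = 0 := by
      have : Real.sin φ * o.im = 0 := by linarith
      exact (mul_eq_zero.1 this).resolve_left hS
    rw [h5] at h1 h2 h3 h4
    have h6 : o.re = arcCentre φ ψ := by
      have : (o.re - arcCentre φ ψ) * ((apex φ ψ).re - Real.cos φ) = 0 := by linarith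
      exact sub_eq_zero.1 ((mul_eq_zero.1 this).resolve_right hq0)
    rw [h6] at h1 h4
    linarith
  · intro hz
    refine ⟨(arcCentre φ ψ : ℂ), Real.sqrt ((Real.cos φ - arcCentre φ ψ) ^ 2 + Real.sin φ ^ 2), ?_⟩
    have key : ∀ p : ℂ, p.re * p.re + p.im * p.im - 1 =
        2 * arcCentre φ ψ * (p.re - Real.cos φ) → dist p (arcCentre φ ψ : ℂ) =
        Real.sqrt ((Real.cos φ - arcCentre φ ψ) ^ 2 + Real.sin φ ^ 2) := by
      intro p hp
      rw [← Real.sqrt_sq (dist_nonneg (x := p)), hsq]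
      congr 1
      simp
      linarith
    intro p hp
    simp only [Set.mem_insert_iff, Set.mem_singleton_iff] at hp
    rcases hp with rfl | rfl | rfl | rfl
    · refine key _ ?_; simp; linarith
    · refine key _ ?_; simp; linarith
    · exact key _ hqc
    · exact key _ hz

lemma conj_image_segment (a b : ℂ) : conj '' segment ℝ a b = segment ℝ (conj a) (conj b) := by
  have := image_segment ℝ (Complex.conjAe.toLinearMap.toAffineMap) a b
  simpa using this

lemma conj_image_edges {φ ψ : ℝ} (hφ : φ ∈ Set.Ioo 0 Real.pi) (hψ : ψ ∈ Set.Icc 0 Real.pi)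
    (hφψ : φ + ψ ≠ Real.pi) : conj '' edges φ ψ = edges φ ψ := by
  have h0 : conj '' edgeZero φ ψ = edgeZero φ ψ := by
    by_cases h : ψ = φ / 2
    · rw [edgeZero, if_pos h, conj_image_segment, ← vertexMinus_eq_conj, segment_symm]
      rw [vertexMinus_eq_conj, Complex.conj_conj]
    · ext z
      constructor
      · rintro ⟨w, hw, rfl⟩
        rw [mem_edgeZero_iff hφ hψ hφψ h] at hw ⊢
        simpa using hw
      · intro hz
        refine ⟨conj z, ?_, Complex.conj_conj z⟩
        rw [mem_edgeZero_iff hφ hψ hφψ h] at hz ⊢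
        simpa using hz
  rw [edges, Set.image_union, Set.image_union, h0, edgePlus, edgeMinus, conj_image_segment,
    conj_image_segment, vertexMinus_eq_conj, Complex.conj_conj]
  simp only [vertexZero, map_one]
  rw [Set.union_comm (segment ℝ _ _)]

lemma conj_image_triangle {φ ψ : ℝ} (hE : conj '' edges φ ψ = edges φ ψ) :
    conj '' triangle φ ψ = triangle φ ψ := by
  have hsub : ∀ z ∈ openTriangle φ ψ, conj z ∈ openTriangle φ ψ := by
    rintro z ⟨hz, hb⟩
    have hEc : conj '' (edges φ ψ)ᶜ = (edges φ ψ)ᶜ := by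
      rw [Set.image_compl_eq (f := conj) (star_involutive (R := ℂ)).bijective, hE]
    have hz' : conj z ∉ edges φ ψ := by
      have : conj z ∈ conj '' (edges φ ψ)ᶜ := ⟨z, hz, rfl⟩
      rwa [hEc] at this
    refine ⟨hz', ?_⟩
    have h1 := Complex.conjLIE.toHomeomorph.image_connectedComponentIn (s := (edges φ ψ)ᶜ) hz
    have h2 : (Complex.conjLIE.toHomeomorph : ℂ → ℂ) = conj := rfl
    rw [h2, hEc] at h1
    rw [← h1]
    exact Complex.conjLIE.lipschitz.isBounded_image hb
  have himg : conj '' openTriangle φ ψ = openTriangle φ ψ := by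
    ext z
    constructor
    · rintro ⟨w, hw, rfl⟩; exact hsub w hw
    · intro hz; exact ⟨conj z, hsub z hz, Complex.conj_conj z⟩
  have h2 : (Complex.conjLIE.toHomeomorph : ℂ → ℂ) = conj := rfl
  rw [triangle, ← h2, Homeomorph.image_closure, h2, himg]

/-! ### The map `T₊` in coordinates centred at `A₋` -/

/-- The unit complex number `e^{it}`. -/
def cis (t : ℝ) : ℂ := Complex.exp (t * Complex.I)

lemma cis_ne_zero (t : ℝ) : cis t ≠ 0 := Complex.exp_ne_zero _

lemma cis_add (s t : ℝ) : cis (s + t) = cis s * cis t := by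
  rw [cis, cis, cis, ← Complex.exp_add]; push_cast; ring_nf

lemma cis_neg (t : ℝ) : cis (-t) = (cis t)⁻¹ := by
  rw [cis, cis, ← Complex.exp_neg]; push_cast; ring_nf

lemma cis_sub (s t : ℝ) : cis (s - t) = cis s / cis t := by
  rw [sub_eq_add_neg, cis_add, cis_neg, div_eq_mul_inv]

lemma conj_cis (t : ℝ) : conj (cis t) = (cis t)⁻¹ := by
  rw [← cis_neg, cis, cis, ← Complex.exp_conj]; simp

lemma normSq_cis (t : ℝ) : Complex.normSq (cis t) = 1 := by
  rw [Complex.normSq_eq_norm_sq, cis, Complex.norm_exp_ofReal_mul_I, one_pow]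

lemma ofReal_cos_eq (t : ℝ) : (Real.cos t : ℂ) = (cis t + (cis t)⁻¹) / 2 := by
  rw [← cis_neg, cis, cis, Complex.ofReal_cos, Complex.cos]; push_cast; rfl

lemma ofReal_sin_eq (t : ℝ) : (Real.sin t : ℂ) = ((cis t)⁻¹ - cis t) * Complex.I / 2 := by
  rw [← cis_neg, cis, cis, Complex.ofReal_sin, Complex.sin]; push_cast; rfl

lemma cis_eq (t : ℝ) : cis t = Real.cos t + Real.sin t * Complex.I := by
  rw [cis, Complex.exp_mul_I]; push_cast; rfl

lemma vertexPlus_eq (φ : ℝ) : vertexPlus φ = cis (φ / 2) ^ 2 := by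
  rw [pow_two, ← cis_add, add_halves]; rfl

lemma vertexMinus_eq (φ : ℝ) : vertexMinus φ = (cis (φ / 2) ^ 2)⁻¹ := by
  rw [vertexMinus_eq_conj, vertexPlus_eq, map_pow, conj_cis, inv_pow]

lemma cis_sq_add_one_ne_zero {φ : ℝ} (hφ : φ ∈ Set.Ioo 0 Real.pi) : cis (φ / 2) ^ 2 + 1 ≠ 0 := by
  have h := (cos_half_pos hφ).ne'
  intro h0
  apply h
  have hu := cis_ne_zero (φ / 2)
  have : (Real.cos (φ / 2) : ℂ) = 0 := by
    rw [ofReal_cos_eq]; field_simp; simpa using h0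
  exact_mod_cast this

lemma apex_eq {φ : ℝ} (hφ : φ ∈ Set.Ioo 0 Real.pi) (ψ : ℝ) :
    apex φ ψ = (cis (φ / 2) ^ 2 * cis ψ ^ 2 + 1) / (cis (φ / 2) ^ 2 + 1) := by
  have h1 := cis_sq_add_one_ne_zero hφ
  have hu := cis_ne_zero (φ / 2)
  have hw := cis_ne_zero ψ
  have hc : (Real.cos (φ / 2) : ℂ) = (cis (φ / 2) ^ 2 + 1) / (2 * cis (φ / 2)) := by
    rw [ofReal_cos_eq]; field_simp
  rw [apex, radius, ← cis, Complex.ofReal_div, hc, ofReal_cos_eq, cis_add]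
  field_simp

/-- The value at `A₋` of the denominator of `T₊`. -/
def denTip (φ ψ : ℝ) : ℂ :=
  -((cis (φ / 2) ^ 2 - (cis (φ / 2) ^ 2)⁻¹) / 2) * (apex φ ψ - 1) * (cis (φ / 2) ^ 2)⁻¹

/-- The slope of the denominator of `T₊`. -/
def denSlope (φ ψ : ℝ) : ℂ := (cis ψ ^ 2 - cis (φ / 2) ^ 2) / 2

/-- The slope of (numerator of `T₊`) - `A₊` * (denominator of `T₊`), an affine function that
vanishes at `A₋`. -/
def numSlope (φ ψ : ℝ) : ℂ := (apex φ ψ - cis (φ / 2) ^ 2) * (1 - cis (φ / 2) ^ 2) / 2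

/-- The denominator of `T₊`. -/
def den (φ ψ : ℝ) (z : ℂ) : ℂ := denTip φ ψ + denSlope φ ψ * (z - vertexMinus φ)

/-- The numerator of `T₊`. -/
def num (φ ψ : ℝ) (z : ℂ) : ℂ := vertexPlus φ * den φ ψ z + numSlope φ ψ * (z - vertexMinus φ)

lemma mapPlus_eq {φ : ℝ} (hφ : φ ∈ Set.Ioo 0 Real.pi) (ψ : ℝ) (z : ℂ) :
    mapPlus φ ψ z = num φ ψ z / den φ ψ z := by
  have h1 := cis_sq_add_one_ne_zero hφ
  have hu := cis_ne_zero (φ / 2)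
  have hw := cis_ne_zero ψ
  have hc : (Real.cos (φ / 2) : ℂ) = (cis (φ / 2) ^ 2 + 1) / (2 * cis (φ / 2)) := by
    rw [ofReal_cos_eq]; field_simp
  have hC : (Real.cos φ : ℂ) = (cis (φ / 2) ^ 2 + (cis (φ / 2) ^ 2)⁻¹) / 2 := by
    rw [ofReal_cos_eq, pow_two, ← cis_add, add_halves]
  have e1 : Complex.exp (((1 : ℝ) : ℂ) * ψ * Complex.I) = cis ψ := by simp [cis]
  have e2 : Complex.exp (((1 : ℝ) : ℂ) * (φ / 2) * Complex.I) = cis (φ / 2) := by simp [cis]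
  have e3 : Complex.exp (((1 : ℝ) : ℂ) * (ψ - φ / 2) * Complex.I) = cis ψ / cis (φ / 2) := by
    rw [← cis_sub]; simp [cis]
  have hq : (radius φ ψ : ℂ) =
      (cis (φ / 2) ^ 2 * cis ψ ^ 2 + 1) / (cis (φ / 2) ^ 2 + 1) / cis ψ := by
    rw [← apex_eq hφ, apex, ← cis]; field_simp
  rw [mapPlus, moebius, e1, e2, e3, num, den, denTip, denSlope, numSlope, vertexPlus_eq,
    vertexMinus_eq, apex_eq hφ, hq, hC, hc]
  congr 1
  · field_simp
    ring
  · field_simp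
    ring

lemma mapMinus_eq (φ ψ : ℝ) (z : ℂ) : mapMinus φ ψ z = conj (mapPlus φ ψ (conj z)) := by
  simp only [mapMinus, mapPlus, moebius, map_div₀, map_add, map_sub, map_mul, Complex.conj_ofReal,
    Complex.conj_conj, ← Complex.exp_conj, map_one, Complex.conj_I, Complex.ofReal_neg,
    Complex.ofReal_one, map_ofNat]
  ring_nf

lemma den_vertexPlus {φ : ℝ} (hφ : φ ∈ Set.Ioo 0 Real.pi) (ψ : ℝ) :
    den φ ψ (vertexPlus φ) =
      (cis (φ / 2) ^ 2 - (cis (φ / 2) ^ 2)⁻¹) / 2 * (apex φ ψ - cis (φ / 2) ^ 2) := by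
  have h1 := cis_sq_add_one_ne_zero hφ
  have hu := cis_ne_zero (φ / 2)
  rw [den, denTip, denSlope, vertexPlus_eq, vertexMinus_eq, apex_eq hφ]
  field_simp
  ring

lemma num_vertexPlus {φ : ℝ} (hφ : φ ∈ Set.Ioo 0 Real.pi) (ψ : ℝ) :
    num φ ψ (vertexPlus φ) = den φ ψ (vertexPlus φ) := by
  have hu := cis_ne_zero (φ / 2)
  rw [num, den_vertexPlus hφ, numSlope, vertexPlus_eq, vertexMinus_eq]
  ring

/-- `T₊(1) = r e^{iψ}`. -/
lemma mapPlus_one {φ : ℝ} (hφ : φ ∈ Set.Ioo 0 Real.pi) (ψ : ℝ) : mapPlus φ ψ 1 = apex φ ψ := by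
  have h : (1 : ℂ) - Real.cos φ ≠ 0 := by
    rw [sub_ne_zero]
    intro h
    have : Real.cos φ < Real.cos 0 :=
      Real.cos_lt_cos_of_nonneg_of_le_pi le_rfl hφ.2.le hφ.1
    rw [Real.cos_zero] at this
    have h' : (1 : ℝ) = Real.cos φ := by exact_mod_cast h
    linarith
  have e1 : Complex.exp (((1 : ℝ) : ℂ) * ψ * Complex.I) = cis ψ := by simp [cis]
  rw [mapPlus, moebius, e1, apex, ← cis, div_eq_iff]
  · ring
  · convert h using 1
    ring

lemma denTip_eq {φ : ℝ} (hφ : φ ∈ Set.Ioo 0 Real.pi) (ψ : ℝ) :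
    denTip φ ψ = 2 * Real.sin (φ / 2) * Real.sin ψ * (cis ψ / cis (φ / 2)) := by
  have h1 := cis_sq_add_one_ne_zero hφ
  have hu := cis_ne_zero (φ / 2)
  have hw := cis_ne_zero ψ
  rw [denTip, apex_eq hφ, ofReal_sin_eq, ofReal_sin_eq]
  field_simp
  rw [Complex.I_sq]
  ring

lemma denSlope_eq (φ ψ : ℝ) :
    denSlope φ ψ = Complex.I * Real.sin (ψ - φ / 2) * (cis ψ * cis (φ / 2)) := by
  have hu := cis_ne_zero (φ / 2)
  have hw := cis_ne_zero ψ
  rw [denSlope, ofReal_sin_eq, cis_sub]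
  field_simp
  rw [Complex.I_sq]
  ring

lemma numSlope_eq {φ : ℝ} (hφ : φ ∈ Set.Ioo 0 Real.pi) (ψ : ℝ) {P ω : ℝ}
    (h1 : P * Real.cos ω = Real.sin φ * Real.cos ψ - Real.sin ψ)
    (h2 : P * Real.sin ω = Real.sin φ * Real.sin ψ) :
    numSlope φ ψ =
      -(Real.sin (φ / 2) * P / Real.cos (φ / 2)) * (cis (φ / 2) ^ 2 * cis ψ / cis ω) := by
  have h1' := cis_sq_add_one_ne_zero hφ
  have hu := cis_ne_zero (φ / 2)
  have hw := cis_ne_zero ψ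
  have hP : (P : ℂ) / cis ω = Real.sin φ / cis ψ - Real.sin ψ := by
    rw [div_eq_mul_inv, div_eq_mul_inv, ← cis_neg, ← cis_neg, cis_eq, cis_eq]
    simp only [Real.cos_neg, Real.sin_neg]
    have h1c : (P : ℂ) * Real.cos ω = Real.sin φ * Real.cos ψ - Real.sin ψ := by exact_mod_cast h1
    have h2c : (P : ℂ) * Real.sin ω = Real.sin φ * Real.sin ψ := by exact_mod_cast h2
    push_cast at *
    linear_combination h1c - Complex.I * h2c
  have hc : (Real.cos (φ / 2) : ℂ) = (cis (φ / 2) ^ 2 + 1) / (2 * cis (φ / 2)) := by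
    rw [ofReal_cos_eq]; field_simp
  have hS : (Real.sin φ : ℂ) =
      ((cis (φ / 2) ^ 2)⁻¹ - cis (φ / 2) ^ 2) * Complex.I / 2 := by
    rw [ofReal_sin_eq, pow_two, ← cis_add, add_halves]
  rw [show -((Real.sin (φ / 2) : ℂ) * P / Real.cos (φ / 2)) * (cis (φ / 2) ^ 2 * cis ψ / cis ω) =
    -((Real.sin (φ / 2) : ℂ) / Real.cos (φ / 2)) * (cis (φ / 2) ^ 2 * cis ψ) * (P / cis ω) by ring,
    hP, hS, hc, ofReal_sin_eq, ofReal_sin_eq, numSlope, apex_eq hφ]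
  field_simp
  ring_nf
  simp only [Complex.I_sq]
  ring

/-- If `D B = B̄ · (tip denominator)¯ · k`, where `B` joins `A` to the centre `m`, the power of the
image of `Ā + ζ` is a combination of the power of `Ā + ζ` and of `|ζ|²`. -/
lemma power_identity (A k dA e ζ : ℂ) (m lam D : ℝ) (hlam : lam ^ 2 = Complex.normSq (m - A))
    (hk : conj (m - A) * conj dA * k = D * (m - A)) :
    lam ^ 2 * Complex.normSq (dA + e * ζ)
        - Complex.normSq (A * (dA + e * ζ) + k * ζ - m * (dA + e * ζ)) =
      D * (lam ^ 2 - Complex.normSq (conj A + ζ - m)) +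
        (2 * (conj (m - A) * conj e * k).re - Complex.normSq k + D) * Complex.normSq ζ := by
  have hk' := congrArg conj hk
  have h2 : ((2 * (conj (m - A) * conj e * k).re : ℝ) : ℂ) =
      conj (m - A) * conj e * k + conj (conj (m - A) * conj e * k) := by
    rw [Complex.add_conj]
  have hlam' : ((lam ^ 2 : ℝ) : ℂ) = (m - A) * conj (m - A) := by
    rw [hlam, Complex.mul_conj]
  apply Complex.ofReal_injective
  rw [Complex.ofReal_sub, Complex.ofReal_mul, Complex.ofReal_add, Complex.ofReal_mul,
    Complex.ofReal_mul, Complex.ofReal_add, Complex.ofReal_sub, Complex.ofReal_sub, h2, hlam']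
  simp only [← Complex.mul_conj, map_add, map_sub, map_mul, Complex.conj_conj,
    Complex.conj_ofReal] at hk hk' ⊢
  linear_combination ζ * hk + conj ζ * hk'

/-! ### The invariant disc -/

/-- The polar coordinates `P`, `ω` of `sin φ cos ψ - sin ψ + i sin φ sin ψ`. The number `ω - φ/2`
is the signed angle at `A₊` between `s₊` and the circle of `s₀`. -/
lemma exists_polar {φ ψ : ℝ} (hφ : φ ∈ Set.Ioo 0 Real.pi) (hψ : ψ ∈ Set.Ioo 0 Real.pi)
    (h1 : φ + ψ < Real.pi) (h2 : Real.sin (φ - ψ) ≤ 2 * Real.sin ψ) :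
    ∃ P ω : ℝ, 0 < P ∧ P * Real.cos ω = Real.sin φ * Real.cos ψ - Real.sin ψ ∧
      P * Real.sin ω = Real.sin φ * Real.sin ψ ∧ φ / 2 ≤ ω ∧ ω < Real.pi - φ / 2 := by
  have hS := Real.sin_pos_of_pos_of_lt_pi hφ.1 hφ.2
  have hs := sin_half_pos hφ
  have hsψ := Real.sin_pos_of_pos_of_lt_pi hψ.1 hψ.2
  have hφ1 := hφ.1
  have hφ2 := hφ.2
  set z : ℂ := ⟨Real.sin φ * Real.cos ψ - Real.sin ψ, Real.sin φ * Real.sin ψ⟩ with hz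
  have e1 : ‖z‖ * Real.cos z.arg = Real.sin φ * Real.cos ψ - Real.sin ψ :=
    Complex.norm_mul_cos_arg z
  have e2 : ‖z‖ * Real.sin z.arg = Real.sin φ * Real.sin ψ := Complex.norm_mul_sin_arg z
  have hP : 0 < ‖z‖ := by
    refine norm_pos_iff.2 fun h => ?_
    have := congrArg Complex.im h
    simp only [hz, Complex.zero_im] at this
    exact (mul_pos hS hsψ).ne' this
  have hsin : 0 < Real.sin z.arg :=
    pos_of_mul_pos_right (e2 ▸ mul_pos hS hsψ) hP.le
  have hω0 : 0 < z.arg := by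
    by_contra! h
    exact absurd (Real.sin_nonpos_of_nonpos_of_neg_pi_le h (Complex.neg_pi_lt_arg z).le) hsin.not_ge
  have hωπ : z.arg ≤ Real.pi := Complex.arg_le_pi z
  refine ⟨‖z‖, z.arg, hP, e1, e2, ?_, ?_⟩
  · by_contra! h
    have hneg : Real.sin (z.arg - φ / 2) < 0 :=
      Real.sin_neg_of_neg_of_neg_pi_lt (by linarith) (by linarith)
    have : ‖z‖ * Real.sin (z.arg - φ / 2) =
        Real.sin (φ / 2) * (2 * Real.sin ψ - Real.sin (φ - ψ)) := by
      rw [Real.sin_sub, Real.sin_sub, cos_eq_half φ]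
      rw [sin_eq_half φ] at e1 e2 ⊢
      linear_combination Real.cos (φ / 2) * e2 - Real.sin (φ / 2) * e1
    have h3 : 0 ≤ Real.sin (φ / 2) * (2 * Real.sin ψ - Real.sin (φ - ψ)) :=
      mul_nonneg hs.le (by linarith)
    have := mul_neg_of_pos_of_neg hP hneg
    linarith
  · by_contra! h
    have hneg : Real.sin (z.arg + φ / 2) ≤ 0 := by
      rw [← Real.sin_sub_two_pi]
      exact Real.sin_nonpos_of_nonpos_of_neg_pi_le (by linarith) (by linarith)
    have : ‖z‖ * Real.sin (z.arg + φ / 2) = Real.sin (φ / 2) * Real.sin (φ + ψ) := by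
      rw [Real.sin_add, Real.sin_add, cos_eq_half φ]
      rw [sin_eq_half φ] at e1 e2 ⊢
      linear_combination Real.cos (φ / 2) * e2 + Real.sin (φ / 2) * e1
    have h3 : 0 < Real.sin (φ / 2) * Real.sin (φ + ψ) :=
      mul_pos hs (Real.sin_pos_of_pos_of_lt_pi (by linarith [hψ.1]) h1)
    have := mul_nonpos_of_nonneg_of_nonpos hP.le hneg
    linarith

lemma normSq_vertexPlus_sub (φ m : ℝ) :
    Complex.normSq ((m : ℂ) - vertexPlus φ) = 1 - 2 * m * Real.cos φ + m ^ 2 := by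
  rw [Complex.normSq_apply]
  simp only [Complex.sub_re, Complex.sub_im, Complex.ofReal_re, Complex.ofReal_im, vertexPlus_re,
    vertexPlus_im]
  linear_combination Real.sin_sq_add_cos_sq φ

lemma depth_conj (m lam : ℝ) (z : ℂ) : depth m lam (conj z) = depth m lam z := by
  unfold depth
  rw [← Complex.norm_conj (z - m), map_sub, Complex.conj_ofReal]

/-- A disc centred on the positive real axis whose boundary circle passes through `A₊` and has
there a tangent that is invariant under the derivative of `T₊ ∘ conj` (this is `hk`) is mapped into
itself. The hypothesis `hDle` says that `A₊` is not a repelling fixed point. -/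
lemma tangentContraction_mapPlus {φ ψ m lam D : ℝ} (hφ : φ ∈ Set.Ioo 0 Real.pi) (hm : 0 < m)
    (hlam : lam ^ 2 = 1 - 2 * m * Real.cos φ + m ^ 2) (hD : 0 < D)
    (hk : conj ((m : ℂ) - vertexPlus φ) * conj (denTip φ ψ) * numSlope φ ψ =
      D * ((m : ℂ) - vertexPlus φ))
    (hdet : Complex.normSq (numSlope φ ψ * denTip φ ψ) = D ^ 2)
    (hDle : D ≤ Complex.normSq (denTip φ ψ)) :
    ∃ v, TangentContraction m lam D v (vertexPlus φ) (mapPlus φ ψ ∘ conj)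
      (fun z => Complex.normSq (den φ ψ (conj z))) := by
  have hS := Real.sin_pos_of_pos_of_lt_pi hφ.1 hφ.2
  have hlam' : lam ^ 2 = Complex.normSq ((m : ℂ) - vertexPlus φ) := by
    rw [normSq_vertexPlus_sub, hlam]
  have hC : Real.cos φ < 1 := by
    have := Real.cos_lt_cos_of_nonneg_of_le_pi le_rfl hφ.2.le hφ.1
    rwa [Real.cos_zero] at this
  have hk0 : numSlope φ ψ * denTip φ ψ ≠ 0 := by
    intro h
    rw [h, map_zero] at hdet
    exact (pow_pos hD 2).ne hdet
  have hkn : numSlope φ ψ ≠ 0 := left_ne_zero_of_mul hk0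
  have hdn : denTip φ ψ ≠ 0 := right_ne_zero_of_mul hk0
  set v := 2 * (conj ((m : ℂ) - vertexPlus φ) * conj (denSlope φ ψ) * numSlope φ ψ).re
    - Complex.normSq (numSlope φ ψ) + D with hv
  have key : ∀ z : ℂ, lam ^ 2 * Complex.normSq (den φ ψ z)
      - Complex.normSq (num φ ψ z - m * den φ ψ z) =
      D * depth m lam z + v * Complex.normSq (z - vertexMinus φ) := by
    intro z
    have := power_identity (vertexPlus φ) (numSlope φ ψ) (denTip φ ψ) (denSlope φ ψ)
      (z - vertexMinus φ) m lam D hlam' hk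
    rw [← vertexMinus_eq_conj, add_sub_cancel] at this
    rw [depth, ← Complex.normSq_eq_norm_sq]
    exact this
  have htip : depth m lam (vertexPlus φ) = 0 := by
    rw [depth, hlam', ← Complex.normSq_eq_norm_sq, ← Complex.normSq_neg, neg_sub, sub_self]
  -- the sign of `v` is that of the power of `1 = T₊(A₊)`, which is positive since `m > 0`
  have hvpos : 0 < v := by
    have h1 := key (vertexPlus φ)
    rw [num_vertexPlus hφ, htip, mul_zero, zero_add] at h1
    have h2 : den φ ψ (vertexPlus φ) - m * den φ ψ (vertexPlus φ) =
        ((1 - m : ℝ) : ℂ) * den φ ψ (vertexPlus φ) := by push_cast; ring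
    rw [h2, Complex.normSq_mul, Complex.normSq_ofReal] at h1
    have hne : den φ ψ (vertexPlus φ) ≠ 0 := by
      rw [den_vertexPlus hφ]
      refine mul_ne_zero (div_ne_zero ?_ two_ne_zero) ?_
      · rw [← vertexMinus_eq, ← vertexPlus_eq]
        intro h
        have := congrArg Complex.im h
        rw [Complex.sub_im, vertexPlus_im, vertexMinus_im, Complex.zero_im] at this
        linarith
      · intro h
        apply hkn
        rw [numSlope, h, zero_mul, zero_div]
    have h3 := Complex.normSq_pos.2 hne
    have h4 : 0 < v * Complex.normSq (vertexPlus φ - vertexMinus φ) := by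
      rw [← h1, hlam]
      have : 0 < (2 * m * (1 - Real.cos φ)) * Complex.normSq (den φ ψ (vertexPlus φ)) :=
        mul_pos (mul_pos (by linarith) (by linarith)) h3
      linarith
    exact pos_of_mul_pos_left h4 (Complex.normSq_nonneg _)
  have hden : ∀ z, 0 ≤ depth m lam z → den φ ψ z ≠ 0 := by
    intro z hz h
    have h1 := key z
    rw [h, map_zero, mul_zero, mul_zero, sub_zero] at h1
    have h2 := mul_nonneg hD.le hz
    have h3 := Complex.normSq_nonneg (num φ ψ z)
    have h4 : Complex.normSq (z - vertexMinus φ) ≤ 0 := by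
      by_contra! h5
      have := mul_pos hvpos h5
      linarith
    have h5 : z - vertexMinus φ = 0 :=
      Complex.normSq_eq_zero.1 (le_antisymm h4 (Complex.normSq_nonneg _))
    rw [den, h5, mul_zero, add_zero] at h
    exact hdn h
  refine ⟨v, hD, hvpos, ?_, ?_, ?_, ?_, ?_, htip, ?_⟩
  · intro z hz
    exact Complex.normSq_pos.2 (hden _ (by rwa [depth_conj]))
  · unfold den
    fun_prop
  · intro z hz
    have hd := hden (conj z) (by rwa [depth_conj])
    have h1 := key (conj z)
    rw [depth_conj, vertexMinus_eq_conj, ← map_sub, Complex.normSq_conj] at h1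
    rw [← Complex.normSq_eq_norm_sq, ← h1, Function.comp_apply, mapPlus_eq hφ, depth,
      ← Complex.normSq_eq_norm_sq, sub_mul, ← Complex.normSq_mul, sub_mul,
      div_mul_cancel₀ _ hd]
  · intro z w hz hw
    have hdz := hden (conj z) (by rwa [depth_conj])
    have hdw := hden (conj w) (by rwa [depth_conj])
    rw [← hdet, ← Complex.normSq_eq_norm_sq, ← Complex.normSq_eq_norm_sq,
      ← Complex.normSq_conj (z - w), ← Complex.normSq_mul, ← Complex.normSq_mul,
      ← Complex.normSq_mul, Function.comp_apply, Function.comp_apply, mapPlus_eq hφ, mapPlus_eq hφ]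
    congr 1
    rw [div_sub_div _ _ hdz hdw, div_mul_cancel₀ _ (mul_ne_zero hdz hdw), map_sub]
    simp only [num, den]
    ring
  · rw [Function.comp_apply, ← vertexMinus_eq_conj, mapPlus_eq hφ, num, den]
    simp [hdn]
  · rw [← vertexMinus_eq_conj, den]
    simpa using hDle

/-- For `φ + ψ < π` and `sin (φ - ψ) ≤ 2 sin ψ` the disc through `A₊` and `A₋` whose boundary is
perpendicular at `A₊` to the bisector of `s₊` and `s₀` is mapped into itself. -/
theorem exists_disc {φ ψ : ℝ} (hφ : φ ∈ Set.Ioo 0 Real.pi) (hψ : ψ ∈ Set.Ioo 0 Real.pi)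
    (h1 : φ + ψ < Real.pi) (h2 : Real.sin (φ - ψ) ≤ 2 * Real.sin ψ) :
    ∃ m lam D v, 0 < m ∧ 0 < lam ∧ lam ^ 2 = 1 - 2 * m * Real.cos φ + m ^ 2 ∧
      (0 < Real.sin (ψ - φ / 2) → m ≤ arcCentre φ ψ) ∧
      TangentContraction m lam D v (vertexPlus φ) (mapPlus φ ψ ∘ conj)
        (fun z => Complex.normSq (den φ ψ (conj z))) := by
  obtain ⟨P, ω, hP, e1, e2, hω1, hω2⟩ := exists_polar hφ hψ h1 h2
  have hS := Real.sin_pos_of_pos_of_lt_pi hφ.1 hφ.2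
  have hs := sin_half_pos hφ
  have hc := cos_half_pos hφ
  have hsψ := Real.sin_pos_of_pos_of_lt_pi hψ.1 hψ.2
  have hφ1 := hφ.1
  have hφ2 := hφ.2
  set θ := (3 * (φ / 2) - ω) / 2 with hθ
  have hcθ : 0 < Real.cos θ := Real.cos_pos_of_mem_Ioo ⟨by linarith, by linarith⟩
  set lam := Real.sin φ / Real.cos θ with hlam
  have hlamθ : lam * Real.cos θ = Real.sin φ := div_mul_cancel₀ _ hcθ.ne'
  have hlampos : 0 < lam := by positivity
  set m := Real.cos φ + lam * Real.sin θ with hm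
  have hmθ : m * Real.cos θ = Real.cos (φ - θ) := by
    rw [Real.cos_sub]
    linear_combination Real.sin θ * hlamθ
  have hmpos : 0 < m := by
    have : 0 < Real.cos (φ - θ) := Real.cos_pos_of_mem_Ioo ⟨by linarith, by linarith⟩
    exact pos_of_mul_pos_left (hmθ ▸ this) hcθ.le
  set D := 2 * Real.sin (φ / 2) ^ 2 * Real.sin ψ * P / Real.cos (φ / 2) with hD
  have hDpos : 0 < D := by positivity
  have hB : (m : ℂ) - vertexPlus φ = -Complex.I * lam * cis θ := by
    rw [cis_eq]
    apply Complex.ext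
    · simp [-Complex.ofReal_cos, -Complex.ofReal_sin, hm]
    · simp [-Complex.ofReal_cos, -Complex.ofReal_sin, hlamθ]
  have hlam2 : lam ^ 2 = 1 - 2 * m * Real.cos φ + m ^ 2 := by
    rw [← normSq_vertexPlus_sub, hB]
    simp [normSq_cis, pow_two]
  have hnorm : Complex.normSq (denTip φ ψ) = 4 * Real.sin (φ / 2) ^ 2 * Real.sin ψ ^ 2 := by
    rw [denTip_eq hφ]
    simp only [map_mul, map_div₀, normSq_cis, Complex.normSq_ofReal, Complex.normSq_ofNat]
    ring
  have hnormk : Complex.normSq (numSlope φ ψ) =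
      (Real.sin (φ / 2) * P / Real.cos (φ / 2)) ^ 2 := by
    rw [numSlope_eq hφ ψ e1 e2, Complex.normSq_mul, Complex.normSq_neg]
    simp only [map_mul, map_div₀, map_pow, normSq_cis, Complex.normSq_ofReal]
    ring
  have hk : conj ((m : ℂ) - vertexPlus φ) * conj (denTip φ ψ) * numSlope φ ψ =
      D * ((m : ℂ) - vertexPlus φ) := by
    have hu := cis_ne_zero (φ / 2)
    have hw := cis_ne_zero ψ
    have hg := cis_ne_zero θ
    have hE := cis_ne_zero ω
    have hcc : (Real.cos (φ / 2) : ℂ) ≠ 0 := by exact_mod_cast hc.ne'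
    have hgg : cis θ * cis θ * cis ω = cis (φ / 2) ^ 3 := by
      rw [pow_succ, pow_two, ← cis_add, ← cis_add, ← cis_add, ← cis_add]
      congr 1
      rw [hθ]; ring
    rw [hB, denTip_eq hφ, numSlope_eq hφ ψ e1 e2, hD]
    simp only [map_mul, map_div₀, map_neg, Complex.conj_I, conj_cis, Complex.conj_ofReal,
      Complex.ofReal_mul, Complex.ofReal_div, Complex.ofReal_pow, Complex.ofReal_ofNat, map_ofNat]
    field_simp
    linear_combination (lam * Real.sin (φ / 2) ^ 2 * Real.sin ψ * P : ℂ) * hgg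
  have hdet : Complex.normSq (numSlope φ ψ * denTip φ ψ) = D ^ 2 := by
    rw [Complex.normSq_mul, hnorm, hnormk, hD]
    field_simp
    ring
  have hDle : D ≤ Complex.normSq (denTip φ ψ) := by
    have h3 : Real.sin (φ / 2) ≤ Real.sin ω := by
      have h4 := Real.sin_sub_sin ω (φ / 2)
      have h5 : 0 ≤ Real.sin ((ω - φ / 2) / 2) :=
        Real.sin_nonneg_of_nonneg_of_le_pi (by linarith) (by linarith)
      have h6 : 0 ≤ Real.cos ((ω + φ / 2) / 2) :=
        Real.cos_nonneg_of_mem_Icc ⟨by linarith, by linarith⟩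
      have := mul_nonneg h5 h6
      linarith
    have h4 : P ≤ 2 * Real.cos (φ / 2) * Real.sin ψ := by
      refine le_of_mul_le_mul_right ?_ hs
      calc P * Real.sin (φ / 2) ≤ P * Real.sin ω := by gcongr
        _ = _ := by rw [e2, sin_eq_half φ]; ring
    rw [hnorm, hD, div_le_iff₀ hc]
    calc _ ≤ 2 * Real.sin (φ / 2) ^ 2 * Real.sin ψ * (2 * Real.cos (φ / 2) * Real.sin ψ) := by
          gcongr
      _ = _ := by ring
  obtain ⟨v, hv⟩ := tangentContraction_mapPlus hφ hmpos hlam2 hDpos hk hdet hDle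
  refine ⟨m, lam, D, v, hmpos, hlampos, hlam2, fun hpos => ?_, hv⟩
  rw [arcCentre, le_div_iff₀ (by positivity)]
  have e3 : P * Real.sin (ω - φ) =
      Real.sin φ * (2 * Real.cos (φ / 2) * Real.sin (ψ - φ / 2)) := by
    rw [Real.sin_sub, Real.sin_sub, cos_eq_half φ]
    rw [sin_eq_half φ] at e1 e2 ⊢
    linear_combination (2 * Real.cos (φ / 2) ^ 2 - 1) * e2 -
      2 * Real.sin (φ / 2) * Real.cos (φ / 2) * e1
  have e4 : m * Real.sin (ω - φ) ≤ Real.sin ω := by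
    have hpos2 : 0 ≤ Real.sin φ * Real.cos (φ / 2 - θ) :=
      mul_nonneg hS.le (Real.cos_nonneg_of_mem_Icc ⟨by linarith, by linarith⟩)
    have h7 : Real.sin ω * Real.cos θ - Real.cos (φ - θ) * Real.sin (ω - φ) =
        Real.sin φ * Real.cos (φ / 2 - θ) := by
      have hω : ω = φ / 2 + φ - 2 * θ := by rw [hθ]; ring
      have p1 : Real.sin ω * Real.cos θ =
          (Real.sin (φ / 2 + φ - θ) + Real.sin (φ / 2 + φ - 3 * θ)) / 2 := by
        rw [show φ / 2 + φ - θ = ω + θ by rw [hω]; ring,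
          show φ / 2 + φ - 3 * θ = ω - θ by rw [hω]; ring, Real.sin_add, Real.sin_sub]
        ring
      have p2 : Real.cos (φ - θ) * Real.sin (ω - φ) =
          (Real.sin (φ / 2 + φ - 3 * θ) - Real.sin (φ / 2 + θ)) / 2 := by
        rw [show φ / 2 + φ - 3 * θ = (ω - φ) + (φ - θ) by rw [hω]; ring,
          show φ / 2 + θ = (φ - θ) - (ω - φ) by rw [hω]; ring, Real.sin_add (ω - φ),
          Real.sin_sub (φ - θ)]
        ring
      have p3 : Real.sin φ * Real.cos (φ / 2 - θ) =
          (Real.sin (φ / 2 + φ - θ) + Real.sin (φ / 2 + θ)) / 2 := by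
        rw [show φ / 2 + φ - θ = φ + (φ / 2 - θ) by ring,
          show φ / 2 + θ = φ - (φ / 2 - θ) by ring, Real.sin_add φ, Real.sin_sub φ]
        ring
      linarith
    refine le_of_mul_le_mul_right ?_ hcθ
    calc m * Real.sin (ω - φ) * Real.cos θ = Real.cos (φ - θ) * Real.sin (ω - φ) := by
          rw [← hmθ]; ring
      _ ≤ _ := by linarith
  refine le_of_mul_le_mul_right ?_ hS
  have e5 : P * (m * Real.sin (ω - φ)) ≤ P * Real.sin ω := by gcongr
  calc _ = m * (P * Real.sin (ω - φ)) := by rw [e3]; ring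
    _ = P * (m * Real.sin (ω - φ)) := by ring
    _ ≤ P * Real.sin ω := e5
    _ = _ := by rw [e2]; ring

/-- The reflection of a tangent contraction in the real axis. -/
lemma TangentContraction.reflect {m lam D v : ℝ} {A : ℂ} {f : ℂ → ℂ} {d : ℂ → ℝ}
    (h : TangentContraction m lam D v A f d) :
    TangentContraction m lam D v (conj A) (fun z => conj (f (conj z))) (fun z => d (conj z)) where
  D_pos := h.D_pos
  v_pos := h.v_pos
  d_pos z hz := h.d_pos _ (by rwa [depth_conj])
  d_cont := h.d_cont.comp Complex.continuous_conj
  depth_map z hz := by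
    have := h.depth_map (conj z) (by rwa [depth_conj])
    rw [depth_conj] at this ⊢
    rw [this, ← Complex.norm_conj (z - conj A), map_sub, Complex.conj_conj]
  dist_map z w hz hw := by
    have := h.dist_map (conj z) (conj w) (by rwa [depth_conj]) (by rwa [depth_conj])
    rw [← map_sub, Complex.norm_conj] at this ⊢
    exact this
  fixed := by rw [Complex.conj_conj, h.fixed]
  depth_tip := by rw [depth_conj, h.depth_tip]
  D_le := by simpa using h.D_le

/-! ### Parameters excluded by the Farey conditions -/

lemma sin_pos_of_isFarey {φ ψ : ℝ} (hφ : φ ∈ Set.Ioo 0 Real.pi) (hψ : ψ ∈ Set.Icc 0 Real.pi)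
    (hφψ : φ + ψ ≠ Real.pi) (hB : IsFarey φ ψ) : 0 < Real.sin ψ := by
  refine lt_of_le_of_ne (Real.sin_nonneg_of_mem_Icc hψ) fun h0 => ?_
  have hS := Real.sin_pos_of_pos_of_lt_pi hφ.1 hφ.2
  have hs := sin_half_pos hφ
  have hne : ψ ≠ φ / 2 := fun h => hs.ne' (by rw [← h, ← h0])
  -- otherwise the arc passes through `A₀`
  have h1 : (1 : ℂ) ∈ edgeZero φ ψ := by
    rw [mem_edgeZero_iff hφ hψ hφψ hne]
    constructor
    · simp [arcCentre, ← h0]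
    · rw [Real.sin_add, Real.sin_sub, ← h0]
      have hC := Real.cos_le_one φ
      have : 0 ≤ (1 - Real.cos φ) * (Real.sin φ * Real.sin (φ / 2) * Real.cos ψ ^ 2) :=
        mul_nonneg (by linarith) (by positivity)
      simp only [Complex.one_re]
      linarith
  have h2 : (1 : ℂ) ∈ edgePlus φ ∩ edgeZero φ ψ := ⟨right_mem_segment ℝ _ _, h1⟩
  rw [hB.edge_plus_zero, Set.mem_singleton_iff] at h2
  have := congrArg Complex.im h2
  rw [vertexPlus_im, Complex.one_im] at this
  exact hS.ne this

/-- If `sin (φ - ψ) > 2 sin ψ` then `s₊` meets `s₀` a second time. -/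
lemma sin_sub_le_of_isFarey {φ ψ : ℝ} (hφ : φ ∈ Set.Ioo 0 Real.pi) (hψ : ψ ∈ Set.Icc 0 Real.pi)
    (hφψ : φ + ψ < Real.pi) (hB : IsFarey φ ψ) : Real.sin (φ - ψ) ≤ 2 * Real.sin ψ := by
  by_contra! hlt
  have hsψ := sin_pos_of_isFarey hφ hψ hφψ.ne hB
  have hS := Real.sin_pos_of_pos_of_lt_pi hφ.1 hφ.2
  have hC : Real.cos φ < 1 := by
    have := Real.cos_lt_cos_of_nonneg_of_le_pi le_rfl hφ.2.le hφ.1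
    rwa [Real.cos_zero] at this
  have hden : 2 * Real.cos (φ / 2) * Real.sin (ψ - φ / 2) = Real.sin ψ - Real.sin (φ - ψ) := by
    rw [Real.sin_sub, Real.sin_sub, cos_eq_half φ, sin_eq_half φ]; ring
  have hsneg : Real.sin (ψ - φ / 2) < 0 := by
    have : 2 * Real.cos (φ / 2) * Real.sin (ψ - φ / 2) < 0 := by rw [hden]; linarith
    exact neg_of_mul_neg_right this (by linarith [cos_half_pos hφ])
  have hne : ψ ≠ φ / 2 := fun h => hsneg.ne (by rw [h, sub_self, Real.sin_zero])
  have hm : arcCentre φ ψ * (Real.sin ψ - Real.sin (φ - ψ)) = Real.sin ψ := by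
    rw [arcCentre, hden, div_mul_cancel₀]
    linarith
  set m := arcCentre φ ψ
  have hm0 : m < 0 := by
    by_contra! h
    nlinarith
  have hm1 : -1 < m := by
    by_contra! h
    nlinarith
  set z : ℂ := (-m) • vertexPlus φ + (1 + m) • (1 : ℂ) with hz
  have hzs : z ∈ edgePlus φ := ⟨-m, 1 + m, by linarith, by linarith, by ring, rfl⟩
  have hre : z.re = -m * Real.cos φ + (1 + m) := by
    simp only [hz, Complex.add_re, Complex.smul_re, vertexPlus_re, Complex.one_re, smul_eq_mul]
    ring
  have him : z.im = -m * Real.sin φ := by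
    simp only [hz, Complex.add_im, Complex.smul_im, vertexPlus_im, Complex.one_im, smul_eq_mul]
    ring
  have hz0 : z ∈ edgeZero φ ψ := by
    rw [mem_edgeZero_iff hφ hψ hφψ.ne hne, Complex.normSq_apply, hre, him]
    constructor
    · linear_combination m ^ 2 * Real.sin_sq_add_cos_sq φ
    · have h1 : -m * Real.cos φ + (1 + m) - Real.cos φ = (1 + m) * (1 - Real.cos φ) := by ring
      rw [h1]
      have h2 : 0 < Real.sin (φ + ψ) :=
        Real.sin_pos_of_pos_of_lt_pi (by linarith [hφ.1, hψ.1]) hφψ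
      have h3 := mul_neg_of_pos_of_neg h2 hsneg
      exact mul_nonneg (mul_nonneg (by linarith) (by linarith)) (by linarith)
  have h2 : z ∈ edgePlus φ ∩ edgeZero φ ψ := ⟨hzs, hz0⟩
  rw [hB.edge_plus_zero, Set.mem_singleton_iff] at h2
  have := congrArg Complex.im h2
  rw [vertexPlus_im, him] at this
  nlinarith

/-- The function that vanishes on the circle of the arc `s₀` and is negative inside. -/
def circleFun (φ ψ : ℝ) (z : ℂ) : ℝ :=
  Complex.normSq z - 1 - 2 * arcCentre φ ψ * (z.re - Real.cos φ)

/-- The function that vanishes on the rays from `A₀` through `A₊` and `A₋` and is negative in the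
wedge between them. -/
def wedgeFun (φ : ℝ) (z : ℂ) : ℝ :=
  z.re * Real.cos (φ / 2) + |z.im| * Real.sin (φ / 2) - Real.cos (φ / 2)

lemma continuous_circleFun (φ ψ : ℝ) : Continuous (circleFun φ ψ) := by
  unfold circleFun
  exact (Complex.continuous_normSq.sub continuous_const).sub
    (continuous_const.mul (Complex.continuous_re.sub continuous_const))

lemma continuous_wedgeFun (φ : ℝ) : Continuous (wedgeFun φ) := by
  unfold wedgeFun
  exact ((Complex.continuous_re.mul continuous_const).add
    (Complex.continuous_im.abs.mul continuous_const)).sub continuous_const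

/-- The defining equation of the lines carrying `s₊` and `s₋`, at `A₊` and `A₋`. -/
lemma wedge_identity (φ : ℝ) : Real.cos φ * Real.cos (φ / 2) + Real.sin φ * Real.sin (φ / 2) =
    Real.cos (φ / 2) := by
  rw [← Real.cos_sub]; congr 1; ring

lemma wedge_of_mem_sides {φ : ℝ} (hφ : φ ∈ Set.Ioo 0 Real.pi) {z : ℂ}
    (hz : z ∈ edgePlus φ ∪ edgeMinus φ) : wedgeFun φ z = 0 ∧ Real.cos φ ≤ z.re := by
  have hS := Real.sin_pos_of_pos_of_lt_pi hφ.1 hφ.2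
  have hC := Real.cos_le_one φ
  have key := wedge_identity φ
  rcases hz with ⟨a, b, ha, hb, hab, rfl⟩ | ⟨a, b, ha, hb, hab, rfl⟩
  · have hre : (a • vertexPlus φ + b • vertexZero).re = a * Real.cos φ + b := by
      simp [vertexZero, -Complex.ofReal_cos]
    have him : (a • vertexPlus φ + b • vertexZero).im = a * Real.sin φ := by
      simp [vertexZero]
    rw [wedgeFun, hre, him, abs_of_nonneg (by positivity)]
    obtain rfl : b = 1 - a := by linarith
    exact ⟨by linear_combination a * key, by nlinarith⟩
  · have hre : (a • vertexMinus φ + b • vertexZero).re = a * Real.cos φ + b := by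
      simp [vertexZero, -Complex.ofReal_cos]
    have him : (a • vertexMinus φ + b • vertexZero).im = -(a * Real.sin φ) := by
      simp [vertexZero]
    rw [wedgeFun, hre, him, abs_neg, abs_of_nonneg (by positivity)]
    obtain rfl : b = 1 - a := by linarith
    exact ⟨by linear_combination a * key, by nlinarith⟩

lemma mem_sides_of_wedge {φ : ℝ} (hφ : φ ∈ Set.Ioo 0 Real.pi) {z : ℂ}
    (hz : wedgeFun φ z = 0) (hre : Real.cos φ ≤ z.re) : z ∈ edgePlus φ ∪ edgeMinus φ := by
  have hs := sin_half_pos hφ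
  have hc := cos_half_pos hφ
  have key := wedge_identity φ
  have hC : 0 < 1 - Real.cos φ := by
    have := Real.cos_lt_cos_of_nonneg_of_le_pi le_rfl hφ.2.le hφ.1
    rw [Real.cos_zero] at this
    linarith
  rw [wedgeFun] at hz
  have h1 : z.re ≤ 1 := by
    have := mul_nonneg (abs_nonneg z.im) hs.le
    by_contra! h
    nlinarith
  set a := (1 - z.re) / (1 - Real.cos φ) with ha
  have ha' : a * (1 - Real.cos φ) = 1 - z.re := div_mul_cancel₀ _ hC.ne'
  have ha0 : 0 ≤ a := div_nonneg (by linarith) hC.le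
  have ha1 : a ≤ 1 := (div_le_one hC).2 (by linarith)
  have him : |z.im| = a * Real.sin φ := by
    refine mul_right_cancel₀ hs.ne' ?_
    linear_combination hz - a * key - Real.cos (φ / 2) * ha'
  rcases le_total 0 z.im with h | h
  · rw [abs_of_nonneg h] at him
    refine Or.inl ⟨a, 1 - a, ha0, by linarith, by ring, ?_⟩
    apply Complex.ext
    · simp only [vertexZero, Complex.add_re, Complex.smul_re, vertexPlus_re, Complex.one_re,
        smul_eq_mul]
      linarith
    · simp only [vertexZero, Complex.add_im, Complex.smul_im, vertexPlus_im, Complex.one_im,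
        smul_eq_mul]
      linarith
  · rw [abs_of_nonpos h] at him
    refine Or.inr ⟨a, 1 - a, ha0, by linarith, by ring, ?_⟩
    apply Complex.ext
    · simp only [vertexZero, Complex.add_re, Complex.smul_re, vertexMinus_re, Complex.one_re,
        smul_eq_mul]
      linarith
    · simp only [vertexZero, Complex.add_im, Complex.smul_im, vertexMinus_im, Complex.one_im,
        smul_eq_mul]
      linarith

/-- On the line `A₊A₋` both functions have the sign of `|Im z| - sin φ`. -/
lemma signs_on_chord {φ ψ : ℝ} (hφ : φ ∈ Set.Ioo 0 Real.pi) {z : ℂ} (hre : z.re = Real.cos φ) :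
    (circleFun φ ψ z ≤ 0 ↔ |z.im| ≤ Real.sin φ) ∧ (wedgeFun φ z ≤ 0 ↔ |z.im| ≤ Real.sin φ) ∧
      (circleFun φ ψ z < 0 ↔ |z.im| < Real.sin φ) ∧
        (wedgeFun φ z < 0 ↔ |z.im| < Real.sin φ) := by
  have hS := Real.sin_pos_of_pos_of_lt_pi hφ.1 hφ.2
  have hs := sin_half_pos hφ
  have h1 : circleFun φ ψ z = (|z.im| - Real.sin φ) * (|z.im| + Real.sin φ) := by
    rw [circleFun, Complex.normSq_apply, hre]
    linear_combination Real.sin_sq_add_cos_sq φ - sq_abs z.im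
  have h2 : wedgeFun φ z = (|z.im| - Real.sin φ) * Real.sin (φ / 2) := by
    rw [wedgeFun, hre]
    linear_combination wedge_identity φ
  have hpos : 0 < |z.im| + Real.sin φ := by positivity
  rw [h1, h2, mul_nonpos_iff_pos_imp_nonpos, mul_nonpos_iff_pos_imp_nonpos]
  refine ⟨?_, ?_, ?_, ?_⟩
  · constructor
    · intro h; by_contra! h'; exact absurd (h.1 (by linarith)) hpos.not_ge
    · intro h; exact ⟨fun h' => by linarith, fun _ => by linarith⟩
  · constructor
    · intro h; by_contra! h'; exact absurd (h.1 (by linarith)) hs.not_ge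
    · intro h; exact ⟨fun h' => by linarith, fun _ => by linarith⟩
  · rw [← sub_neg (b := Real.sin φ)]
    exact ⟨fun h => neg_of_mul_neg_left h hpos.le, fun h => mul_neg_of_neg_of_pos h hpos⟩
  · rw [← sub_neg (b := Real.sin φ)]
    exact ⟨fun h => neg_of_mul_neg_left h hs.le, fun h => mul_neg_of_neg_of_pos h hs⟩

lemma mem_sides_of_chord {φ : ℝ} {z : ℂ} (hre : z.re = Real.cos φ)
    (him : |z.im| = Real.sin φ) : z ∈ edgePlus φ ∪ edgeMinus φ := by
  rcases abs_eq_abs.1 (him.trans (abs_of_nonneg (him ▸ abs_nonneg _)).symm) with h | h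
  · have : z = vertexPlus φ := Complex.ext (by simpa using hre) (by simpa using h)
    exact Or.inl (this ▸ left_mem_segment ℝ _ _)
  · have : z = vertexMinus φ := Complex.ext (by simpa using hre) (by simpa using h)
    exact Or.inr (this ▸ left_mem_segment ℝ _ _)

lemma circleFun_eq (φ ψ : ℝ) (z : ℂ) : circleFun φ ψ z =
    Complex.normSq (z - arcCentre φ ψ) - Complex.normSq ((arcCentre φ ψ : ℂ) - vertexPlus φ) := by
  rw [normSq_vertexPlus_sub, circleFun, Complex.normSq_apply, Complex.normSq_apply]
  simp only [Complex.sub_re, Complex.sub_im, Complex.ofReal_re, Complex.ofReal_im]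
  ring

lemma isBounded_circleFun_nonpos (φ ψ : ℝ) : Bornology.IsBounded {z | circleFun φ ψ z ≤ 0} := by
  refine (Metric.isBounded_closedBall (x := (arcCentre φ ψ : ℂ))
    (r := ‖(arcCentre φ ψ : ℂ) - vertexPlus φ‖)).subset fun z hz => ?_
  rw [Set.mem_ofPred_eq, circleFun_eq, Complex.normSq_eq_norm_sq, Complex.normSq_eq_norm_sq,
    sub_nonpos] at hz
  rw [Metric.mem_closedBall, dist_eq_norm]
  exact (sq_le_sq₀ (norm_nonneg _) (norm_nonneg _)).1 hz

lemma isBounded_segment (a b : ℂ) : Bornology.IsBounded (segment ℝ a b) := by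
  rw [segment_eq_image_lineMap]
  exact (isCompact_Icc.image AffineMap.lineMap_continuous).isBounded

lemma isBounded_edges {φ ψ : ℝ} (hφ : φ ∈ Set.Ioo 0 Real.pi) (hψ : ψ ∈ Set.Icc 0 Real.pi)
    (hφψ : φ + ψ ≠ Real.pi) : Bornology.IsBounded (edges φ ψ) := by
  refine ((isBounded_segment _ _).union (isBounded_segment _ _)).union ?_
  by_cases h : ψ = φ / 2
  · rw [edgeZero, if_pos h]
    exact isBounded_segment _ _
  · refine (isBounded_circleFun_nonpos φ ψ).subset fun z hz => ?_
    have := ((mem_edgeZero_iff hφ hψ hφψ h z).1 hz).1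
    exact (sub_eq_zero.2 this).le

lemma isCompact_triangle {φ ψ : ℝ} (hE : Bornology.IsBounded (edges φ ψ)) :
    IsCompact (triangle φ ψ) := by
  obtain ⟨R, hR⟩ := hE.subset_closedBall 0
  have h1 := triangle_subset_closedBall (abs_nonneg R)
    (hR.trans (Metric.closedBall_subset_closedBall (le_abs_self R)))
  exact (isCompact_closedBall _ _).of_isClosed_subset isClosed_closure h1

lemma vertexZero_mem_image {φ ψ : ℝ} (hB : IsFarey φ ψ) :
    (1 : ℂ) ∈ mapPlus φ ψ '' triangle φ ψ := by
  have : (1 : ℂ) ∈ mapPlus φ ψ '' triangle φ ψ ∩ mapMinus φ ψ '' triangle φ ψ := by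
    rw [hB.separation]; rfl
  exact this.1

lemma denTip_ne_zero {φ ψ : ℝ} (hφ : φ ∈ Set.Ioo 0 Real.pi) (hsψ : 0 < Real.sin ψ) :
    denTip φ ψ ≠ 0 := by
  rw [denTip_eq hφ]
  have h1 : (Real.sin (φ / 2) : ℂ) ≠ 0 := by exact_mod_cast (sin_half_pos hφ).ne'
  have h2 : (Real.sin ψ : ℂ) ≠ 0 := by exact_mod_cast hsψ.ne'
  exact mul_ne_zero (mul_ne_zero (mul_ne_zero two_ne_zero h1) h2)
    (div_ne_zero (cis_ne_zero _) (cis_ne_zero _))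

lemma numSlope_ne_zero {φ ψ : ℝ} (hφ : φ ∈ Set.Ioo 0 Real.pi) (hψ : ψ ∈ Set.Icc 0 Real.pi)
    (hφψ : φ + ψ ≠ Real.pi) (h : ψ ≠ φ / 2) : numSlope φ ψ ≠ 0 := by
  have hS := Real.sin_pos_of_pos_of_lt_pi hφ.1 hφ.2
  rw [numSlope, ← vertexPlus_eq]
  refine div_ne_zero (mul_ne_zero (sub_ne_zero.2 fun h0 => ?_) (sub_ne_zero.2 fun h0 => ?_))
    two_ne_zero
  · have h1 := apex_re_sub (ψ := ψ) hφ
    rw [h0, vertexPlus_re, sub_self] at h1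
    exact div_ne_zero (neg_ne_zero.2 (mul_ne_zero (sin_add_ne_zero hφ hψ hφψ)
      (sin_sub_half_ne_zero hφ hψ h))) (cos_half_pos hφ).ne' h1.symm
  · have := congrArg Complex.im h0
    rw [vertexPlus_im, Complex.one_im] at this
    exact hS.ne this

/-- The pole of `T₊`. -/
def pole (φ ψ : ℝ) : ℂ := vertexMinus φ - denTip φ ψ / denSlope φ ψ

/-- The pole of `T₊` lies on the tangent of the unit circle at `A₋`. -/
lemma pole_re_im {φ ψ : ℝ} (hφ : φ ∈ Set.Ioo 0 Real.pi) (h : Real.sin (ψ - φ / 2) ≠ 0) {y : ℝ}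
    (hy : y = 2 * Real.sin (φ / 2) * Real.sin ψ / Real.sin (ψ - φ / 2)) :
    (pole φ ψ).re = Real.cos φ + Real.sin φ * y ∧
      (pole φ ψ).im = -Real.sin φ + Real.cos φ * y := by
  have hz : pole φ ψ = vertexMinus φ * (1 + y * Complex.I) := by
    have hc : (Real.sin (ψ - φ / 2) : ℂ) ≠ 0 := by exact_mod_cast h
    have hu := cis_ne_zero (φ / 2)
    have hw := cis_ne_zero ψ
    rw [pole, denTip_eq hφ, denSlope_eq, hy, vertexMinus_eq]
    simp only [Complex.ofReal_mul, Complex.ofReal_div, Complex.ofReal_ofNat]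
    generalize (Real.sin (ψ - φ / 2) : ℂ) = x at hc ⊢
    field_simp
    linear_combination (-2 * Real.sin (φ / 2) * Real.sin ψ : ℂ) * Complex.I_sq
  rw [hz]
  constructor
  · simp [-Complex.ofReal_cos, -Complex.ofReal_sin]
  · simp [-Complex.ofReal_cos, -Complex.ofReal_sin]
    ring

lemma circleFun_pole {φ ψ : ℝ} (hφ : φ ∈ Set.Ioo 0 Real.pi) (h : Real.sin (ψ - φ / 2) ≠ 0) :
    circleFun φ ψ (pole φ ψ) = 0 := by
  obtain ⟨h1, h2⟩ := pole_re_im (ψ := ψ) hφ h rfl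
  have hc := (cos_half_pos hφ).ne'
  rw [circleFun, Complex.normSq_apply, h1, h2, arcCentre, sin_eq_half φ]
  have key := Real.sin_sq_add_cos_sq φ
  rw [sin_eq_half φ] at key
  set s := Real.sin (ψ - φ / 2)
  set c := Real.cos (φ / 2)
  set C := Real.cos φ
  field_simp
  linear_combination c * (s ^ 2 + 4 * Real.sin (φ / 2) ^ 2 * Real.sin ψ ^ 2) * key

/-- The pole of `T₊` is not in the closure of an open set of bounded components. -/
lemma pole_notMem_closure {φ ψ : ℝ} (hφ : φ ∈ Set.Ioo 0 Real.pi) (hψ : ψ ∈ Set.Icc 0 Real.pi)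
    (hφψ : φ + ψ ≠ Real.pi) (h : ψ ≠ φ / 2) (hB : IsFarey φ ψ) {W : Set ℂ}
    (hW : W ⊆ openTriangle φ ψ) (hp : pole φ ψ ∉ W) : pole φ ψ ∉ closure W := by
  intro hcl
  have hsψ := sin_pos_of_isFarey hφ hψ hφψ hB
  have hs : (Real.sin (ψ - φ / 2) : ℂ) ≠ 0 := by
    exact_mod_cast sin_sub_half_ne_zero hφ hψ h
  have he : denSlope φ ψ ≠ 0 := by
    rw [denSlope_eq]
    exact mul_ne_zero (mul_ne_zero Complex.I_ne_zero hs)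
      (mul_ne_zero (cis_ne_zero _) (cis_ne_zero _))
  have hdT := denTip_ne_zero hφ hsψ
  have hsub : pole φ ψ - vertexMinus φ = -(denTip φ ψ / denSlope φ ψ) := by rw [pole]; ring
  have hpole : den φ ψ (pole φ ψ) = 0 := by
    rw [den, hsub]; field_simp; ring
  have hden : ∀ z, z ≠ pole φ ψ → den φ ψ z ≠ 0 := fun z hz h0 => by
    apply hz
    have : denSlope φ ψ * (z - pole φ ψ) = den φ ψ z - den φ ψ (pole φ ψ) := by rw [den, den]; ring
    rw [h0, hpole, sub_zero] at this
    exact sub_eq_zero.1 ((mul_eq_zero.1 this).resolve_left he)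
  obtain ⟨R, hR⟩ := isBounded_iff_forall_norm_le.1
    (isCompact_triangle (isBounded_edges hφ hψ hφψ)).isBounded
  have hle : ∀ z ∈ W, ‖num φ ψ z‖ ≤ R * ‖den φ ψ z‖ := by
    intro z hz
    have hd := hden z fun h0 => hp (h0 ▸ hz)
    have h1 := hR _ (hB.inclusion_plus ⟨z, subset_closure (hW hz), rfl⟩)
    rwa [mapPlus_eq hφ, norm_div, div_le_iff₀ (norm_pos_iff.2 hd)] at h1
  have hclosed : IsClosed {z | ‖num φ ψ z‖ ≤ R * ‖den φ ψ z‖} := by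
    refine isClosed_le ?_ ?_
    · unfold num den; fun_prop
    · unfold den; fun_prop
  have h2 : ‖num φ ψ (pole φ ψ)‖ ≤ R * ‖den φ ψ (pole φ ψ)‖ :=
    closure_minimal hle hclosed hcl
  rw [hpole, norm_zero, mul_zero, norm_le_zero_iff, num, hpole, mul_zero, zero_add, hsub] at h2
  exact mul_ne_zero (numSlope_ne_zero hφ hψ hφψ h) (neg_ne_zero.2 (div_ne_zero hdT he)) h2

/-- The segment from the pole to the centre of the circle of `s₀` starts inside every
neighbourhood of the pole and runs inside the circle. -/
lemma pole_mem_closure {φ ψ : ℝ} (hφ : φ ∈ Set.Ioo 0 Real.pi) (h : Real.sin (ψ - φ / 2) ≠ 0)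
    {U W : Set ℂ} (hU : IsOpen U) (hpU : pole φ ψ ∈ U)
    (hUW : ∀ z ∈ U, circleFun φ ψ z < 0 → z ∈ W) : pole φ ψ ∈ closure W := by
  set p := pole φ ψ
  set m : ℂ := (arcCentre φ ψ : ℂ)
  have hp : Complex.normSq (p - m) - Complex.normSq (m - vertexPlus φ) = 0 := by
    rw [← circleFun_eq]; exact circleFun_pole hφ h
  have hpos : 0 < Complex.normSq (m - vertexPlus φ) := by
    refine Complex.normSq_pos.2 fun h0 => ?_
    have := congrArg Complex.im h0
    rw [Complex.sub_im, vertexPlus_im, Complex.ofReal_im, Complex.zero_im] at this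
    linarith [Real.sin_pos_of_pos_of_lt_pi hφ.1 hφ.2]
  have htend : Filter.Tendsto (fun t : ℝ => p + t * (m - p)) (nhdsWithin 0 (Set.Ioi 0))
      (nhds p) := by
    have : Continuous fun t : ℝ => p + t * (m - p) := by fun_prop
    have h1 := this.tendsto 0
    simp only [Complex.ofReal_zero, zero_mul, add_zero] at h1
    exact h1.mono_left nhdsWithin_le_nhds
  refine mem_closure_of_tendsto htend ?_
  have hlt : ∀ᶠ t : ℝ in nhdsWithin 0 (Set.Ioi 0), t < 1 :=
    nhdsWithin_le_nhds (gt_mem_nhds one_pos)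
  filter_upwards [htend (hU.mem_nhds hpU), hlt, self_mem_nhdsWithin] with t ht1 ht2 ht3
  refine hUW _ ht1 ?_
  have ht3 : 0 < t := ht3
  have h1 : p + t * (m - p) - m = ((1 - t : ℝ) : ℂ) * (p - m) := by push_cast; ring
  rw [circleFun_eq, h1, Complex.normSq_mul, Complex.normSq_ofReal, sub_eq_zero.1 hp]
  have := mul_pos (mul_pos ht3 (show 0 < 2 - t by linarith)) hpos
  change _ - Complex.normSq (m - vertexPlus φ) < 0
  linarith

/-- If `φ + ψ > π` and `ψ > φ/2` then the triangle lies between the arc and the two segments, and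
the pole of `T₊` is on the arc. -/
lemma false_of_lt_of_half_lt {φ ψ : ℝ} (hφ : φ ∈ Set.Ioo 0 Real.pi) (hψ : ψ ∈ Set.Icc 0 Real.pi)
    (hφψ : Real.pi < φ + ψ) (h : φ / 2 < ψ) (hB : IsFarey φ ψ) : False := by
  have hS := Real.sin_pos_of_pos_of_lt_pi hφ.1 hφ.2
  have hsψ := sin_pos_of_isFarey hφ hψ hφψ.ne' hB
  have hs := sin_half_pos hφ
  have hd : 0 < Real.sin (ψ - φ / 2) :=
    Real.sin_pos_of_pos_of_lt_pi (by linarith) (by linarith [hφ.1, hψ.2])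
  have hadd : Real.sin (φ + ψ) < 0 := by
    rw [← Real.sin_sub_two_pi]
    exact Real.sin_neg_of_neg_of_neg_pi_lt (by linarith [hφ.2, hψ.2]) (by linarith)
  have hside : 0 < -(Real.sin (φ + ψ) * Real.sin (ψ - φ / 2)) :=
    neg_pos.2 (mul_neg_of_neg_of_pos hadd hd)
  have hmem := mem_edgeZero_iff hφ hψ hφψ.ne' h.ne'
  have hcg := continuous_circleFun φ ψ
  have hch := continuous_wedgeFun φ
  set U : Set ℂ := {z | Real.cos φ < z.re ∧ 0 < wedgeFun φ z} with hUdef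
  have hU : IsOpen U := (isOpen_lt continuous_const Complex.continuous_re).inter
    (isOpen_lt continuous_const hch)
  set W : Set ℂ := {z | circleFun φ ψ z < 0} ∩ U with hW
  have hWo : IsOpen W := (isOpen_lt hcg continuous_const).inter hU
  have hWcl : closure W ⊆ {z | circleFun φ ψ z ≤ 0 ∧ Real.cos φ ≤ z.re ∧ 0 ≤ wedgeFun φ z} := by
    refine closure_minimal (fun z hz => ⟨hz.1.le, hz.2.1.le, hz.2.2.le⟩) ?_
    exact (isClosed_le hcg continuous_const).inter
      ((isClosed_le continuous_const Complex.continuous_re).inter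
        (isClosed_le continuous_const hch))
  have hWE : W ⊆ openTriangle φ ψ := by
    refine subset_openTriangle hWo
      ((isBounded_circleFun_nonpos φ ψ).subset fun z hz => LT.lt.le (a := circleFun φ ψ z) hz.1) ?_ ?_
    · rw [Set.disjoint_left]
      rintro z ⟨hz1, hz2, hz3⟩ (hz | hz)
      · exact hz3.ne' (wedge_of_mem_sides hφ hz).1
      · exact (LT.lt.ne hz1) (sub_eq_zero.2 ((hmem z).1 hz).1)
    · rw [hWo.frontier_eq]
      rintro z ⟨hz, hzW⟩
      obtain ⟨h1, h2, h3⟩ := hWcl hz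
      rcases h1.lt_or_eq with h1 | h1
      · rcases h2.lt_or_eq with h2 | h2
        · rcases h3.lt_or_eq with h3 | h3
          · exact absurd ⟨h1, h2, h3⟩ hzW
          · exact Or.inl (mem_sides_of_wedge hφ h3.symm h2.le)
        · have h4 := signs_on_chord (ψ := ψ) hφ h2.symm
          exact absurd (h4.2.2.2.2 (h4.2.2.1.1 h1)) h3.not_gt
      · exact Or.inr ((hmem z).2 ⟨sub_eq_zero.1 h1, mul_nonneg (by linarith) hside.le⟩)
  have hp := circleFun_pole hφ hd.ne'
  refine pole_notMem_closure hφ hψ hφψ.ne' h.ne' hB hWE (fun hpW => (LT.lt.ne hpW.1) hp)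
    (pole_mem_closure hφ hd.ne' hU ?_ fun z hz hz' => ⟨hz', hz⟩)
  obtain ⟨h1, h2⟩ := pole_re_im (ψ := ψ) hφ hd.ne' rfl
  set y := 2 * Real.sin (φ / 2) * Real.sin ψ / Real.sin (ψ - φ / 2)
  have hy : 0 < y := by positivity
  refine ⟨by rw [h1]; nlinarith, ?_⟩
  rw [wedgeFun, h1, h2]
  have h5 : Real.sin φ - Real.cos φ * y ≤ |-Real.sin φ + Real.cos φ * y| := by
    rw [← abs_neg]; refine le_trans (le_of_eq ?_) (le_abs_self _); ring
  have h6 : Real.sin φ * Real.cos (φ / 2) - Real.cos φ * Real.sin (φ / 2) = Real.sin (φ / 2) := by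
    rw [← Real.sin_sub]; congr 1; ring
  have h7 := mul_le_mul_of_nonneg_right h5 hs.le
  have h8 := wedge_identity φ
  have h9 : 0 < y * Real.sin (φ / 2) := by positivity
  have h10 : y * (Real.sin φ * Real.cos (φ / 2) - Real.cos φ * Real.sin (φ / 2)) =
    y * Real.sin (φ / 2) := by rw [h6]
  linarith

/-- If `φ + ψ > π` and `ψ < φ/2` then the triangle is the union of a circular segment and a
straight triangle, and the pole of `T₊` is on the arc. -/
lemma false_of_lt_of_lt_half {φ ψ : ℝ} (hφ : φ ∈ Set.Ioo 0 Real.pi) (hψ : ψ ∈ Set.Icc 0 Real.pi)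
    (hφψ : Real.pi < φ + ψ) (h : ψ < φ / 2) (hB : IsFarey φ ψ) : False := by
  have hS := Real.sin_pos_of_pos_of_lt_pi hφ.1 hφ.2
  have hsψ := sin_pos_of_isFarey hφ hψ hφψ.ne' hB
  have hs := sin_half_pos hφ
  have hc := cos_half_pos hφ
  have hd : Real.sin (ψ - φ / 2) < 0 :=
    Real.sin_neg_of_neg_of_neg_pi_lt (by linarith) (by linarith [hφ.2, hψ.1])
  have hadd : Real.sin (φ + ψ) < 0 := by
    rw [← Real.sin_sub_two_pi]
    exact Real.sin_neg_of_neg_of_neg_pi_lt (by linarith [hφ.2, hψ.2]) (by linarith)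
  have hside : -(Real.sin (φ + ψ) * Real.sin (ψ - φ / 2)) < 0 :=
    neg_lt_zero.2 (mul_pos_of_neg_of_neg hadd hd)
  have hmem := mem_edgeZero_iff hφ hψ hφψ.ne' h.ne
  have hcg := continuous_circleFun φ ψ
  have hch := continuous_wedgeFun φ
  set W : Set ℂ := {z | (Real.cos φ < z.re ∨ circleFun φ ψ z < 0) ∧
    (z.re < Real.cos φ ∨ wedgeFun φ z < 0)} with hW
  have hWo : IsOpen W := ((isOpen_lt continuous_const Complex.continuous_re).union
    (isOpen_lt hcg continuous_const)).inter ((isOpen_lt Complex.continuous_re continuous_const).union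
      (isOpen_lt hch continuous_const))
  set K : Set ℂ := {z | (z.re ≤ Real.cos φ ∧ circleFun φ ψ z ≤ 0) ∨
    (Real.cos φ ≤ z.re ∧ wedgeFun φ z ≤ 0)} with hK
  have hWK : W ⊆ K := by
    rintro z ⟨h1, h2⟩
    rcases le_or_gt z.re (Real.cos φ) with h3 | h3
    · exact Or.inl ⟨h3, (h1.resolve_left h3.not_gt).le⟩
    · exact Or.inr ⟨h3.le, (h2.resolve_left h3.not_gt).le⟩
  have hWcl : closure W ⊆ K := by
    refine closure_minimal hWK ?_
    exact ((isClosed_le Complex.continuous_re continuous_const).inter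
      (isClosed_le hcg continuous_const)).union
        ((isClosed_le continuous_const Complex.continuous_re).inter
          (isClosed_le hch continuous_const))
  have hKb : Bornology.IsBounded K := by
    have hw : Bornology.IsBounded {z : ℂ | Real.cos φ ≤ z.re ∧ wedgeFun φ z ≤ 0} := by
      refine isBounded_iff_forall_norm_le.2 ⟨1 + Real.sin φ, fun z hz => ?_⟩
      obtain ⟨h1, h2⟩ := hz
      rw [wedgeFun] at h2
      have h8 := wedge_identity φ
      have h3 : |z.im| ≤ Real.sin φ := by
        have := mul_le_mul_of_nonneg_right h1 hc.le
        refine le_of_mul_le_mul_right ?_ hs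
        linarith
      have h4 : z.re ≤ 1 := by
        have := mul_nonneg (abs_nonneg z.im) hs.le
        refine le_of_mul_le_mul_right ?_ hc
        linarith
      have h5 : |z.re| ≤ 1 := abs_le.2 ⟨(Real.neg_one_le_cos φ).trans h1, h4⟩
      exact (Complex.norm_le_abs_re_add_abs_im z).trans (add_le_add h5 h3)
    refine (((isBounded_circleFun_nonpos φ ψ).union hw)).subset ?_
    rintro z (hz | hz)
    · exact Or.inl hz.2
    · exact Or.inr hz
  have hWE : W ⊆ openTriangle φ ψ := by
    refine subset_openTriangle hWo (hKb.subset hWK) ?_ ?_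
    · rw [Set.disjoint_left]
      rintro z ⟨hz1, hz2⟩ (hz | hz)
      · obtain ⟨h1, h2⟩ := wedge_of_mem_sides hφ hz
        rcases hz2 with h3 | h3
        · exact h3.not_ge h2
        · exact h3.ne h1
      · obtain ⟨h1, h2⟩ := (hmem z).1 hz
        rcases hz1 with h3 | h3
        · have := mul_neg_of_pos_of_neg (sub_pos.2 h3) hside
          linarith
        · exact h3.ne (sub_eq_zero.2 h1)
    · rw [hWo.frontier_eq]
      rintro z ⟨hz, hzW⟩
      have hzK := hWcl hz
      rcases lt_trichotomy z.re (Real.cos φ) with h3 | h3 | h3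
      · have h1 : circleFun φ ψ z ≤ 0 := by
          rcases hzK with h | h
          exacts [h.2, absurd h.1 h3.not_ge]
        rcases h1.lt_or_eq with h1 | h1
        · exact absurd ⟨Or.inr h1, Or.inl h3⟩ hzW
        · exact Or.inr ((hmem z).2 ⟨sub_eq_zero.1 h1,
            mul_nonneg_of_nonpos_of_nonpos (by linarith) hside.le⟩)
      · have h4 := signs_on_chord (ψ := ψ) hφ h3
        have h1 : |z.im| ≤ Real.sin φ := by
          rcases hzK with h | h
          exacts [h4.1.1 h.2, h4.2.1.1 h.2]
        rcases h1.lt_or_eq with h1 | h1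
        · exact absurd ⟨Or.inr (h4.2.2.1.2 h1), Or.inr (h4.2.2.2.2 h1)⟩ hzW
        · exact Or.inl (mem_sides_of_chord h3 h1)
      · have h1 : wedgeFun φ z ≤ 0 := by
          rcases hzK with h | h
          exacts [absurd h.1 h3.not_ge, h.2]
        rcases h1.lt_or_eq with h1 | h1
        · exact absurd ⟨Or.inl h3, Or.inr h1⟩ hzW
        · exact Or.inl (mem_sides_of_wedge hφ h1 h3.le)
  have hp := circleFun_pole hφ hd.ne
  obtain ⟨h1, h2⟩ := pole_re_im (ψ := ψ) hφ hd.ne rfl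
  set y := 2 * Real.sin (φ / 2) * Real.sin ψ / Real.sin (ψ - φ / 2)
  have hy : y < 0 := div_neg_of_pos_of_neg (by positivity) hd
  have hpre : (pole φ ψ).re < Real.cos φ := by rw [h1]; nlinarith
  refine pole_notMem_closure hφ hψ hφψ.ne' h.ne hB hWE ?_
    (pole_mem_closure hφ hd.ne (isOpen_lt Complex.continuous_re continuous_const) hpre
      fun z hz hz' => ⟨Or.inr hz', Or.inl hz⟩)
  rintro ⟨h3 | h3, -⟩
  · exact h3.not_gt hpre
  · exact h3.ne hp

/-- If `ψ = φ/2` then `T₊` is a similarity of ratio `1 / (2 cos (φ/2))`, which is larger than one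
for `φ + ψ > π`. -/
lemma false_of_lt_of_eq_half {φ : ℝ} (hφ : φ ∈ Set.Ioo 0 Real.pi)
    (hφψ : Real.pi < φ + φ / 2) (hB : IsFarey φ (φ / 2)) : False := by
  have hψ : φ / 2 ∈ Set.Icc 0 Real.pi := ⟨by linarith [hφ.1], by linarith [hφ.1, hφ.2]⟩
  have hS := Real.sin_pos_of_pos_of_lt_pi hφ.1 hφ.2
  have hs := sin_half_pos hφ
  have hc := cos_half_pos hφ
  have hc2 : 2 * Real.cos (φ / 2) < 1 := by
    have := Real.cos_lt_cos_of_nonneg_of_le_pi (x := Real.pi / 3) (y := φ / 2)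
      (by positivity) hψ.2 (by linarith)
    rw [Real.cos_pi_div_three] at this
    linarith
  have hdT := denTip_ne_zero (ψ := φ / 2) hφ hs
  have hu := cis_ne_zero (φ / 2)
  have h1' := cis_sq_add_one_ne_zero hφ
  have hden : ∀ z, den φ (φ / 2) z = denTip φ (φ / 2) := fun z => by
    rw [den, denSlope]; ring
  have hk : numSlope φ (φ / 2) * (2 * Real.cos (φ / 2)) =
      -cis (φ / 2) * denTip φ (φ / 2) := by
    rw [numSlope, denTip, apex_eq hφ, ofReal_cos_eq]
    field_simp
    ring
  have hscale : ∀ z w, 2 * Real.cos (φ / 2) *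
      dist (mapPlus φ (φ / 2) z) (mapPlus φ (φ / 2) w) = dist z w := by
    intro z w
    have h1 : (2 * Real.cos (φ / 2) : ℝ) * (mapPlus φ (φ / 2) z - mapPlus φ (φ / 2) w) =
        -cis (φ / 2) * (z - w) := by
      rw [mapPlus_eq hφ, mapPlus_eq hφ, num, num, hden, hden]
      push_cast at hk ⊢
      field_simp
      linear_combination (z - w) * hk
    have h2 := congrArg norm h1
    rw [norm_mul, norm_mul, norm_neg, Complex.norm_real, Real.norm_of_nonneg (by positivity), cis,
      Complex.norm_exp_ofReal_mul_I, one_mul] at h2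
    rw [dist_eq_norm, dist_eq_norm, h2]
  have hcomp := isCompact_triangle (isBounded_edges hφ hψ hφψ.ne')
  set d := Metric.diam (triangle φ (φ / 2))
  have hdiam : d ≤ 2 * Real.cos (φ / 2) * d := by
    refine Metric.diam_le_of_forall_dist_le (by positivity) fun z hz w hw => ?_
    rw [← hscale]
    gcongr
    exact Metric.dist_le_diam_of_mem hcomp.isBounded (hB.inclusion_plus ⟨z, hz, rfl⟩)
      (hB.inclusion_plus ⟨w, hw, rfl⟩)
  have hd0 : d ≤ 0 := by nlinarith
  have hone : (1 : ℂ) ∈ triangle φ (φ / 2) := hB.inclusion_plus (vertexZero_mem_image hB)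
  have hq : apex φ (φ / 2) ∈ triangle φ (φ / 2) := by
    rw [← mapPlus_one hφ]
    exact hB.inclusion_plus ⟨1, hone, rfl⟩
  have h3 := (Metric.dist_le_diam_of_mem hcomp.isBounded hq hone).trans hd0
  have h4 : apex φ (φ / 2) - 1 = 0 := sub_eq_zero.2 (dist_le_zero.1 h3)
  exact hdT (by rw [denTip, h4]; ring)

lemma add_lt_of_isFarey {φ ψ : ℝ} (hφ : φ ∈ Set.Ioo 0 Real.pi) (hψ : ψ ∈ Set.Icc 0 Real.pi)
    (hφψ : φ + ψ ≠ Real.pi) (hB : IsFarey φ ψ) : φ + ψ < Real.pi := by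
  refine lt_of_le_of_ne (not_lt.1 fun hlt => ?_) hφψ
  rcases lt_trichotomy ψ (φ / 2) with h | rfl | h
  · exact false_of_lt_of_lt_half hφ hψ hlt h hB
  · exact false_of_lt_of_eq_half hφ hlt hB
  · exact false_of_lt_of_half_lt hφ hψ hlt h hB

/-! ### Shrinking of the iterated triangles -/

/-- The map `T₊ ∘ conj` for the digit `1` and `T₋ ∘ conj` for the digit `0`. -/
def branch (φ ψ : ℝ) : Bool → ℂ → ℂ
  | true => mapPlus φ ψ ∘ conj
  | false => mapMinus φ ψ ∘ conj

lemma iterTriangle_eq_image (φ ψ : ℝ) (l : List Bool) :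
    iterTriangle φ ψ l = wordMap (branch φ ψ) l '' triangle φ ψ := by
  induction l with
  | nil => simp [iterTriangle, wordMap]
  | cons b l ih =>
    cases b <;> rw [iterTriangle, ih, wordMap, branch, ← Set.image_comp]

lemma wordMap_concat (F : Bool → ℂ → ℂ) (l : List Bool) (b : Bool) :
    wordMap F (l ++ [b]) = wordMap F l ∘ F b := by
  induction l with
  | nil => rfl
  | cons c l ih => rw [List.cons_append, wordMap, ih, wordMap, Function.comp_assoc]

lemma initial_concat (x : ℕ → Bool) (n : ℕ) : initial x (n + 1) = initial x n ++ [x n] := by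
  rw [initial, List.ofFn_succ_last]; rfl

/-- The edges lie in the invariant disc. For the arc `s₀` this compares two circles through `A₊`
and `A₋` on the side of the line `A₊A₋` on which `s₀` lies. -/
lemma edges_subset_disc {φ ψ m lam : ℝ} (hφ : φ ∈ Set.Ioo 0 Real.pi) (hψ : ψ ∈ Set.Ioo 0 Real.pi)
    (hφψ : φ + ψ < Real.pi) (hm : 0 < m) (hlam : 0 < lam)
    (hlam2 : lam ^ 2 = 1 - 2 * m * Real.cos φ + m ^ 2)
    (hle : 0 < Real.sin (ψ - φ / 2) → m ≤ arcCentre φ ψ) :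
    edges φ ψ ⊆ Metric.closedBall (m : ℂ) lam := by
  have hψ' := Set.Ioo_subset_Icc_self hψ
  have hdepth : ∀ z : ℂ, depth m lam z =
      2 * m * (z.re - Real.cos φ) - (Complex.normSq z - 1) := by
    intro z
    rw [depth, ← Complex.normSq_eq_norm_sq, hlam2, Complex.normSq_apply, Complex.normSq_apply]
    simp only [Complex.sub_re, Complex.sub_im, Complex.ofReal_re, Complex.ofReal_im]
    ring
  have hplus : vertexPlus φ ∈ Metric.closedBall (m : ℂ) lam := by
    rw [← depth_nonneg_iff hlam.le, hdepth, Complex.normSq_apply, vertexPlus_re, vertexPlus_im]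
    linarith [Real.sin_sq_add_cos_sq φ]
  have hminus : vertexMinus φ ∈ Metric.closedBall (m : ℂ) lam := by
    rw [← depth_nonneg_iff hlam.le, hdepth, Complex.normSq_apply, vertexMinus_re, vertexMinus_im]
    linarith [Real.sin_sq_add_cos_sq φ]
  have hzero : vertexZero ∈ Metric.closedBall (m : ℂ) lam := by
    rw [← depth_nonneg_iff hlam.le, hdepth, vertexZero, Complex.normSq_one, Complex.one_re]
    have := mul_nonneg hm.le (sub_nonneg.2 (Real.cos_le_one φ))
    linarith
  have hconv := convex_closedBall (m : ℂ) lam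
  refine Set.union_subset (Set.union_subset (hconv.segment_subset hplus hzero)
    (hconv.segment_subset hminus hzero)) ?_
  by_cases h : ψ = φ / 2
  · rw [edgeZero, if_pos h]
    exact hconv.segment_subset hplus hminus
  · intro z hz
    obtain ⟨h1, h2⟩ := (mem_edgeZero_iff hφ hψ' hφψ.ne h z).1 hz
    have hadd : 0 < Real.sin (φ + ψ) :=
      Real.sin_pos_of_pos_of_lt_pi (by linarith [hφ.1, hψ.1]) hφψ
    have h3 : (z.re - Real.cos φ) * Real.sin (ψ - φ / 2) ≤ 0 := by
      by_contra! h4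
      have := mul_pos h4 hadd
      linarith
    rw [← depth_nonneg_iff hlam.le, hdepth, h1]
    have h5 : 0 ≤ (m - arcCentre φ ψ) * (z.re - Real.cos φ) := by
      rcases lt_or_gt_of_ne (sin_sub_half_ne_zero hφ hψ' h) with h6 | h6
      · have h7 : arcCentre φ ψ ≤ 0 :=
          div_nonpos_of_nonneg_of_nonpos (Real.sin_nonneg_of_mem_Icc hψ')
            (mul_nonpos_of_nonneg_of_nonpos (by linarith [cos_half_pos hφ]) h6.le)
        refine mul_nonneg (by linarith) ?_
        by_contra! h8
        have := mul_pos_of_neg_of_neg h8 h6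
        linarith
      · have h7 := hle h6
        refine mul_nonneg_of_nonpos_of_nonpos (by linarith) ?_
        by_contra! h8
        have := mul_pos h8 h6
        linarith
    linarith

end Bryophyllum
end

theorem mainTheorem3 (φ ψ : ℝ) (hφ : φ ∈ Set.Ioo 0 Real.pi) (hψ : ψ ∈ Set.Icc 0 Real.pi)
    (hφψ : φ + ψ ≠ Real.pi) (hB : Bryophyllum.IsFarey φ ψ) (x : ℕ → Bool) :
    (∀ n : ℕ, Bryophyllum.iterTriangle φ ψ (Bryophyllum.initial x (n + 1)) ⊆
        Bryophyllum.iterTriangle φ ψ (Bryophyllum.initial x n)) ∧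
      ∃ p : ℂ, (⋂ n : ℕ, ⋂ _ : 1 ≤ n,
        Bryophyllum.iterTriangle φ ψ (Bryophyllum.initial x n)) = {p} := by
  open Bryophyllum ComplexConjugate in
  have hlt := add_lt_of_isFarey hφ hψ hφψ hB
  have hsψ := sin_pos_of_isFarey hφ hψ hφψ hB
  have hψ' : ψ ∈ Set.Ioo 0 Real.pi := by
    refine ⟨lt_of_le_of_ne hψ.1 ?_, lt_of_le_of_ne hψ.2 ?_⟩
    · rintro rfl; simp at hsψ
    · rintro rfl; simp at hsψ
  obtain ⟨m, lam, D, v, hm, hlam, hlam2, hle, hT⟩ :=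
    exists_disc hφ hψ' hlt (sin_sub_le_of_isFarey hφ hψ hlt hB)
  have hdisc : ∀ z ∈ triangle φ ψ, 0 ≤ depth m lam z := fun z hz =>
    (depth_nonneg_iff hlam.le z).2 (triangle_subset_closedBall hlam.le
      (edges_subset_disc hφ hψ' hlt hm hlam hlam2 hle) hz)
  let A : Bool → ℂ := fun b => if b then vertexPlus φ else conj (vertexPlus φ)
  let d : Bool → ℂ → ℝ := fun b z =>
    if b then Complex.normSq (den φ ψ (conj z)) else Complex.normSq (den φ ψ (conj (conj z)))
  have hF : ∀ b, TangentContraction m lam D v (A b) (branch φ ψ b) (d b) := by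
    rintro (_ | _)
    · have h := hT.reflect
      have hfun : branch φ ψ false = fun z => conj ((mapPlus φ ψ ∘ conj) (conj z)) := by
        funext z
        simp [branch, mapMinus_eq]
      rw [hfun]
      exact h
    · exact hT
  have hA : A true ≠ A false := by
    intro h
    have h1 := congrArg Complex.im h
    simp only [A, if_true, vertexPlus_im] at h1
    have hS := Real.sin_pos_of_pos_of_lt_pi hφ.1 hφ.2
    simp at h1
    linarith
  have hconj := conj_image_triangle (conj_image_edges hφ hψ hφψ)
  have hstep : ∀ b, branch φ ψ b '' triangle φ ψ ⊆ triangle φ ψ := by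
    rintro (_ | _)
    · rw [branch, Set.image_comp, hconj]; exact hB.inclusion_minus
    · rw [branch, Set.image_comp, hconj]; exact hB.inclusion_plus
  have hnest : ∀ n : ℕ, iterTriangle φ ψ (initial x (n + 1)) ⊆ iterTriangle φ ψ (initial x n) := by
    intro n
    rw [iterTriangle_eq_image, iterTriangle_eq_image, initial_concat, wordMap_concat,
      Set.image_comp]
    exact Set.image_mono (hstep _)
  refine ⟨hnest, ?_⟩
  have hne : (triangle φ ψ).Nonempty := by
    obtain ⟨z, hz, -⟩ := vertexZero_mem_image hB
    exact ⟨z, hz⟩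
  have hcomp : ∀ l, IsCompact (wordMap (branch φ ψ) l '' triangle φ ψ) := by
    intro l
    induction l with
    | nil => simpa [wordMap] using isCompact_triangle (isBounded_edges hφ hψ hφψ)
    | cons b l ih =>
      rw [wordMap, Set.image_comp]
      refine ih.image_of_continuousOn (((hF b).continuousOn hlam.le).mono ?_)
      rintro _ ⟨z, hz, rfl⟩
      exact depth_wordMap_nonneg hF l (hdisc z hz)
  have hmono : Antitone fun n => iterTriangle φ ψ (initial x n) := antitone_nat_of_succ_le hnest
  obtain ⟨p, hp⟩ := IsCompact.nonempty_iInter_of_sequence_nonempty_isCompact_isClosed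
    (fun n => iterTriangle φ ψ (initial x n)) hnest
    (fun n => by rw [iterTriangle_eq_image]; exact hne.image _)
    (by rw [iterTriangle_eq_image]; exact hcomp _)
    (fun n => by rw [iterTriangle_eq_image]; exact (hcomp _).isClosed)
  refine ⟨p, Set.Subset.antisymm (fun q hq => ?_) ?_⟩
  · refine eq_of_forall_dist_le fun ε hε => ?_
    obtain ⟨n, hn⟩ := exists_wordMap_small hF hlam hA x hε
    have hq' : q ∈ iterTriangle φ ψ (initial x n) :=
      hnest n (Set.mem_iInter₂.1 hq (n + 1) (by omega))
    have hp' := Set.mem_iInter.1 hp n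
    simp only [iterTriangle_eq_image] at hq' hp'
    obtain ⟨z, hz, rfl⟩ := hq'
    obtain ⟨w, hw, rfl⟩ := hp'
    rw [dist_eq_norm]
    exact (hn z w (hdisc z hz) (hdisc w hw)).le
  · rw [Set.singleton_subset_iff]
    exact Set.mem_iInter₂.2 fun n _ => Set.mem_iInter.1 hp n
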